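/- Let $\lambda$ be a cardinal and let $\theta_1,\theta_2\le\lambda$ be regular (infinite) cardinals with $\theta_1+\theta_2>\aleph_0$. For a partial order $P$, a $(\kappa_1,\kappa_2)$-pre-cut of $P$ is a pair $(C_1,C_2)$ of subsets of $P$ such that $C_1\cup C_2$ is linearly ordered, $a_1\le a_2$ for all $a_1\in C_1$, $a_2\in C_2$, there is no $c\in P$ with $a_1\le c\le a_2$ for all $a_1\in C_1$, $a_2\in C_2$, the cofinality of $C_1$ is $\kappa_1$, and the cofinality of $C_2$ with the inverse order is $\kappa_2$. For a strict order $(X,<)$ let $\mathfrak t(X,<)$ be the least cardinal $\kappa\ge\aleph_0$ such that some $<$-increasing sequence of length $\kappa$ in $X$ has no $<$-upper bound. A proper filter $D$ on $\lambda$ is regular if there are finite sets $u_i\subseteq\lambda$ $(i<\lambda)$ with $\{i<\lambda:\alpha\in u_i\}\in D$ for every $\alpha<\lambda$. In a reduced power modulo $D$, a relation holds between $f/D$ and $g/D$ iff it holds between $f(i)$ and $g(i)$ for all $i$ in some member of $D$. Then there is a regular proper filter $D$ on $\lambda$ such that: (a) for every dense linear order $(M,\le)$ with at least two elements, the reduced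 power $(M,\le)^\lambda/D$ has a $(\theta_1,\theta_2)$-pre-cut, but it has no $(\kappa_1,\kappa_2)$-pre-cut whenever $\kappa_1,\kappa_2\le\lambda$ are regular cardinals with $\{\theta_1,\theta_2\}\not\subseteq\{\kappa_1,\kappa_2\}$; (b) if $\theta_1\ne\theta_2$, then $\mathfrak t\big(({}^{\omega>}2,\triangleleft)^\lambda/D\big)\ge\lambda^+$, where ${}^{\omega>}2$ is the set of finite binary sequences and $\triangleleft$ is the relation of being a proper initial segment; so every increasing sequence in this reduced power whose length is an infinite cardinal $\le\lambda$ has an upper bound. The same holds for the strict part of the partial order $({}^{\omega>}2,\trianglelefteq)^\lambda/D$, where $\trianglelefteq$ is the relation of being an initial segment. -/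

import Mathlib

universe u v

open Cardinal

/-- The filter `D` on `I` is regular, i.e. `(#I, ℵ₀)`-regular: there are finite sets `U i ⊆ I`
such that every `a : I` belongs to `U i` for `D`-almost all `i`. Equivalently, `D` contains a
family of `#I` sets such that each `i : I` lies in only finitely many of them. -/
def IsRegularFilter {I : Type u} (D : Filter I) : Prop :=
  ∃ U : I → Finset I, ∀ a : I, {i | a ∈ U i} ∈ D

/-- `(C₁, C₂)` is a pre-cut of the partial order `P`. -/
structure IsPreCut {P : Type u} [PartialOrder P] (C₁ C₂ : Set P) : Prop where
  chain : IsChain (· ≤ ·) (C₁ ∪ C₂)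
  le : ∀ a₁ ∈ C₁, ∀ a₂ ∈ C₂, a₁ ≤ a₂
  unfilled : ¬ ∃ c : P, (∀ a₁ ∈ C₁, a₁ ≤ c) ∧ ∀ a₂ ∈ C₂, c ≤ a₂

/-- The partial order `P` has a `(κ₁, κ₂)`-pre-cut: a pre-cut `(C₁, C₂)` such that `C₁` has
cofinality `κ₁` and the inverse order of `C₂` has cofinality `κ₂`. -/
def HasPreCut (P : Type u) [PartialOrder P] (κ₁ κ₂ : Cardinal.{u}) : Prop :=
  ∃ C₁ C₂ : Set P, IsPreCut C₁ C₂ ∧ Order.cof C₁ = κ₁ ∧ Order.cof (C₂)ᵒᵈ = κ₂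

/-- For a strict order relation `r` on `X`, the least infinite cardinal `κ` such that there is an
`r`-increasing sequence of length `κ` with no `r`-upper bound. -/
noncomputable def towerNumber {X : Type u} (r : X → X → Prop) : Cardinal.{u} :=
  sInf {κ : Cardinal.{u} | ℵ₀ ≤ κ ∧ ∃ f : κ.ord.ToType → X,
    (∀ α β, α < β → r (f α) (f β)) ∧ ¬ ∃ x, ∀ α, r (f α) x}

/-- `s` is an initial segment of `t`, for finite binary sequences. -/
def BinPrefix (s t : List Bool) : Prop := s <+: t

/-- `s` is a proper initial segment of `t`, for finite binary sequences. -/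
def BinStrictPrefix (s t : List Bool) : Prop := s <+: t ∧ s ≠ t

/-- The strict tree relation of the reduced power of the full binary tree of finite sequences:
`f / D` is below `g / D` iff `f i` is a proper initial segment of `g i` for `D`-almost all `i`. -/
def treeLT {I : Type u} (D : Filter I) (x y : D.Germ (List Bool)) : Prop :=
  Filter.Germ.LiftRel BinStrictPrefix x y

/-- The strict part of the partial order on the reduced power of the full binary tree which is
given by `f i` being an initial segment of `g i` for `D`-almost all `i`. -/
def treePosetLT {I : Type u} (D : Filter I) (x y : D.Germ (List Bool)) : Prop :=
  Filter.Germ.LiftRel BinPrefix x y ∧ x ≠ y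

-- The filter is generated by three kinds of sets: sets that make it regular, sets saying that
-- functions `q · w` into `ℚ` increase along a chain of type `Θ₁ ⊕ₗ Θ₂ᵒᵈ`, and sets saying that
-- functions `h x` solve saturation problems. A problem consists of a directed index set `J` and
-- relations `E j k` that hold almost everywhere for `j` below `k`; a solution `h` satisfies `i ∈ E
-- j (h i)` almost everywhere, for each `j`. All these functions come from one independent family of
-- `2 ^ λ` functions, so any finitely many values occur together at some `i`; this keeps the
-- requirements consistent. The `2 ^ λ` possible problems are run through `λ⁺` times, so each one
-- whose premises lie in the final filter gets solved. Only problems whose `J` bounds maps from `Θ₁`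
-- or from `Θ₂` are admitted.
--
-- This restriction keeps the chain unfilled in the middle (`exists_mem_inter_lt`). An element
-- filling it would give sets `U ξ`, `V ζ` in the filter, each implied by a finite condition. A
-- `Δ`-system argument thins out the two families of conditions; at the finitely many stages that
-- matter, all values in one family are bounded by a single index, and the other family is raised
-- above it (`exists_settled`). For suitable `ξ`, `ζ` the two conditions are then compatible and
-- share no chain element separating `ξ` from `ζ`, so some `i` satisfies both with the order of `ξ`
-- and `ζ` reversed. Embedding `ℚ` into `M` turns the chain into a pre-cut.
--
-- Conversely, a regular `κ ≠ #Θ` bounds maps from `Θ`. Hence filling a `(κ₁, κ₂)`-pre-cut is an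
-- admitted problem as soon as one `θ` is neither `κ₁` nor `κ₂`, and bounding an increasing sequence
-- in the tree is admitted when `θ₁ ≠ θ₂`.

universe w

/-! ### Large subsets of a regular cardinal and a weak `Δ`-system lemma. -/

/-- A subset of `Θ` is large if it has the same cardinality as `Θ`. -/
def Large {Θ : Type u} (S : Set Θ) : Prop := #Θ ≤ #S

theorem Large.mono {Θ : Type u} {S T : Set Θ} (hS : Large S) (h : S ⊆ T) : Large T :=
  le_trans hS (mk_le_mk_of_subset h)

theorem large_univ {Θ : Type u} : Large (Set.univ : Set Θ) := by
  simp [Large]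

theorem Large.exists_of_subset_iUnion {Θ ι : Type u} (hΘ : (#Θ).IsRegular) (hι : #ι < #Θ)
    {S : Set Θ} (hS : Large S) {A : ι → Set Θ} (h : S ⊆ ⋃ a, A a) : ∃ a, Large (A a) := by
  by_contra hcon
  push Not at hcon
  have h1 : #(⋃ a, A a) < #Θ :=
    (card_iUnion_lt_iff_forall_of_isRegular hΘ hι).2 fun a => not_le.1 (hcon a)
  exact (not_le.2 h1) (hS.mono h)

theorem Large.or_of_subset_union {Θ : Type u} (hΘ : (#Θ).IsRegular) {S A B : Set Θ}
    (hS : Large S) (h : S ⊆ A ∪ B) : Large A ∨ Large B := by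
  by_contra hcon
  push Not at hcon
  have h1 : #(A ∪ B : Set Θ) < #Θ :=
    lt_of_le_of_lt (mk_union_le _ _)
      (add_lt_of_lt hΘ.aleph0_le (not_le.1 hcon.1) (not_le.1 hcon.2))
  exact (not_le.2 h1) (hS.mono h)

theorem Large.diff {Θ : Type u} (hΘ : (#Θ).IsRegular) {S A : Set Θ}
    (hS : Large S) (hA : ¬ Large A) : Large (S \ A) := by
  have := hS.or_of_subset_union hΘ (A := S \ A) (B := A) (by simp)
  tauto

theorem Large.nonempty {Θ : Type u} (hΘ : (#Θ).IsRegular) {S : Set Θ} (hS : Large S) :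
    S.Nonempty := by
  rw [← Set.nonempty_coe_sort, ← mk_ne_zero_iff]
  exact (lt_of_lt_of_le hΘ.pos hS).ne'

theorem Large.diff_biUnion {Θ : Type u} (hΘ : (#Θ).IsRegular) {α : Type v} {S : Set Θ}
    (hS : Large S) (t : Finset α) (A : α → Set Θ) (hA : ∀ a ∈ t, ¬ Large (A a)) :
    Large {ζ ∈ S | ∀ a ∈ t, ζ ∉ A a} := by
  classical
  induction t using Finset.induction_on with
  | empty => simpa using hS
  | insert a t _ ih =>
    have h := (ih fun b hb => hA b (by simp [hb])).diff hΘ (hA a (by simp))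
    refine h.mono fun ζ hζ => ?_
    simp only [Set.mem_sdiff, Set.mem_ofPred_eq, Finset.mem_insert, forall_eq_or_imp] at hζ ⊢
    tauto

/-- A weak form of the `Δ`-system lemma: after shrinking the index set, every point outside a
finite root belongs to few of the sets. -/
theorem Large.exists_root {Θ : Type u} {α : Type v} (hΘ : (#Θ).IsRegular) (hω : ℵ₀ < #Θ)
    {S : Set Θ} (hS : Large S) (s : Θ → Finset α) :
    ∃ (T : Set Θ) (r : Finset α), T ⊆ S ∧ Large T ∧
      ∀ x, x ∉ r → ¬ Large {ζ ∈ T | x ∈ s ζ} := by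
  classical
  obtain ⟨⟨n⟩, hn⟩ := hS.exists_of_subset_iUnion (ι := ULift.{u} ℕ) hΘ (by simpa using hω)
    (A := fun n => {ζ ∈ S | (s ζ).card = n.down})
    (fun ζ hζ => Set.mem_iUnion.2 ⟨⟨(s ζ).card⟩, hζ, rfl⟩)
  let P : ℕ → Prop := fun k => ∃ r : Finset α, r.card = k ∧
    Large {ζ ∈ S | (s ζ).card = n ∧ r ⊆ s ζ}
  have hP0 : P 0 := ⟨∅, rfl, by simpa using hn⟩
  have hPn : ∀ k, P k → k ≤ n := by
    rintro k ⟨r, rfl, hr⟩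
    obtain ⟨ζ, -, h1, h2⟩ := hr.nonempty hΘ
    exact h1 ▸ Finset.card_le_card h2
  -- The root is a set of maximal size contained in `s ζ` for a large set of `ζ`; the fixed size `n`
  -- of the sets bounds its size.
  obtain ⟨r, hrk, hr⟩ := Nat.findGreatest_spec (P := P) (Nat.zero_le n) hP0
  refine ⟨_, r, fun ζ hζ => hζ.1, hr, fun x hx hL => ?_⟩
  have hPk : P (Nat.findGreatest P n + 1) := by
    refine ⟨insert x r, by rw [Finset.card_insert_of_notMem hx, hrk], hL.mono fun ζ hζ => ?_⟩
    exact ⟨hζ.1.1, hζ.1.2.1, Finset.insert_subset hζ.2 hζ.1.2.2⟩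
  have := Nat.le_findGreatest (hPn _ hPk) hPk
  omega

/-! ### Directed sets that bound maps from `Θ`. -/

/-- Every map from `Θ` to `J` is bounded on a large subset of any given large set. -/
def BoundsMaps (Θ : Type u) {J : Type v} (le : J → J → Prop) : Prop :=
  ∀ S : Set Θ, Large S → ∀ φ : Θ → J, ∃ j, Large {ζ ∈ S | le (φ ζ) j}

theorem BoundsMaps.prod {Θ : Type u} {J K : Type*} {r : J → J → Prop} {s : K → K → Prop}
    (hr : BoundsMaps Θ r) (hs : BoundsMaps Θ s) :
    BoundsMaps Θ fun a b : J × K => r a.1 b.1 ∧ s a.2 b.2 := by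
  intro S hS φ
  obtain ⟨j, hj⟩ := hr S hS fun ζ => (φ ζ).1
  obtain ⟨k, hk⟩ := hs _ hj fun ζ => (φ ζ).2
  exact ⟨(j, k), hk.mono fun ζ hζ => ⟨hζ.1.1, hζ.1.2, hζ.2⟩⟩

theorem BoundsMaps.comap {Θ : Type u} {J K : Type*} {r : J → J → Prop}
    (hr : BoundsMaps Θ r) {π : K → J} (hπ : Function.Surjective π) :
    BoundsMaps Θ fun a b : K => r (π a) (π b) := by
  intro S hS φ
  obtain ⟨j, hj⟩ := hr S hS fun ζ => π (φ ζ)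
  obtain ⟨k, rfl⟩ := hπ j
  exact ⟨k, hj⟩

/-- If `#Θ` is smaller than `#A`, the whole range of the map is bounded; if it is larger, regularity
of `#Θ` makes the map constant on a large set. -/
theorem boundsMaps_of_card_ne {Θ A : Type u} (hΘ : (#Θ).IsRegular) (hne : #Θ ≠ #A)
    {r : A → A → Prop} (hrefl : ∀ a, r a a)
    (hbdd : ∀ B : Set A, #B < #A → ∃ a, ∀ b ∈ B, r b a) : BoundsMaps Θ r := by
  intro S hS φ
  rcases hne.lt_or_gt with h | h
  · obtain ⟨a, ha⟩ := hbdd (Set.range φ) (lt_of_le_of_lt mk_range_le h)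
    exact ⟨a, hS.mono fun ζ hζ => ⟨hζ, ha _ ⟨ζ, rfl⟩⟩⟩
  · obtain ⟨a, ha⟩ := hS.exists_of_subset_iUnion hΘ h (A := fun a => {ζ ∈ S | φ ζ = a})
      (fun ζ hζ => Set.mem_iUnion.2 ⟨φ ζ, hζ, rfl⟩)
    exact ⟨a, ha.mono fun ζ hζ => ⟨hζ.1, by rw [hζ.2]; exact hrefl a⟩⟩

/-! ### Independent functions. -/

/-- An infinite set `I` carries `2 ^ #I` functions into a given set of size at most `#I` which
are independent: finitely many of their values can be prescribed. -/
theorem exists_independent_functions (I V : Type u) [Infinite I] [Nonempty V] (hV : #V ≤ #I) :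
    ∃ H : Set I → I → V, ∀ (F : Finset (Set I)) (v : Set I → V), ∃ i, ∀ A ∈ F, H A i = v A := by
  classical
  have hsurj : ∃ π : I → V, Function.Surjective π := by
    obtain ⟨f⟩ := hV
    exact ⟨Function.invFun f, Function.invFun_surjective f.injective⟩
  obtain ⟨π, hπ⟩ := hsurj
  let _ : Zero I := ⟨Classical.arbitrary I⟩
  -- A point codes a finite set `s` and a finite table indexed by finite sets; `H A` looks up the
  -- trace of `A` on `s`. Once `s` separates the members of `F`, their traces are distinct keys, so
  -- the table can be filled at will.
  let I' : Type u := Finset I × (Finset I →₀ I)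
  have hcard : #I' = #I := by
    simp only [I', mk_prod, lift_id, mk_finset_of_infinite, mk_finsupp_of_infinite, max_self]
    exact mul_eq_self (aleph0_le_mk I)
  obtain ⟨e⟩ := Cardinal.eq.1 hcard
  refine ⟨fun A i => π ((e.symm i).2 ((e.symm i).1.filter (· ∈ A))), fun F v => ?_⟩
  choose w hw using fun A => hπ (v A)
  -- a finite set separating the members of `F`
  have hsep : ∀ A B : Set I, ∃ a, A ≠ B → ¬ (a ∈ A ↔ a ∈ B) := by
    intro A B
    by_contra! hcon
    exact (hcon (Classical.arbitrary I)).1 (Set.ext fun a => (hcon a).2)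
  choose d hd using hsep
  let s : Finset I := (F ×ˢ F).image fun P => d P.1 P.2
  have hinj : Set.InjOn (fun A : Set I => s.filter (· ∈ A)) F := by
    intro A hA B hB hAB
    by_contra hne
    have hmem : d A B ∈ s := Finset.mem_image.2 ⟨(A, B), by simp_all, rfl⟩
    have := Finset.ext_iff.1 hAB (d A B)
    simp only [Finset.mem_filter, hmem, true_and] at this
    exact hd A B hne this
  let g : Finset I → I := fun t =>
    if h : ∃ A ∈ F, s.filter (· ∈ A) = t then w h.choose else 0
  have hg : ∀ A ∈ F, g (s.filter (· ∈ A)) = w A := by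
    intro A hA
    have h : ∃ B ∈ F, s.filter (· ∈ B) = s.filter (· ∈ A) := ⟨A, hA, rfl⟩
    have h2 : h.choose = A := hinj h.choose_spec.1 hA h.choose_spec.2
    simp only [g, dif_pos h, h2]
  let φ : Finset I →₀ I := Finsupp.onFinset (F.image fun A => s.filter (· ∈ A)) g (by
    intro t ht
    by_contra hcon
    refine ht (dif_neg ?_)
    rintro ⟨A, hA, rfl⟩
    exact hcon (Finset.mem_image.2 ⟨A, hA, rfl⟩))
  refine ⟨e (s, φ), fun A hA => ?_⟩
  simp only [Equiv.symm_apply_apply, φ, Finsupp.onFinset_apply]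
  rw [hg A hA, hw]

/-! ### Schemes, finite conditions and the filter they generate. -/

/-- The data for an iterated construction of a filter on `I`. At stage `x` there is a directed
relation `le x` on the index set `I` and a family `E x j k` of subsets of `I`; the function
`h x` is meant to satisfy `i ∈ E x j (h x i)` for almost all `i`, for every `j`. The functions `u`
and `q` give a regular filter and a chain of functions to the rationals, indexed by `W`. -/
structure Scheme (I : Type u) (W : Type u) (X : Type u) where
  le : X → I → I → Prop
  E : X → I → I → Set I
  good : X → Prop
  h : X → I → I
  u : I → Finset I
  q : I → W → ℚ
  le_refl : ∀ {x}, good x → ∀ j, le x j j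
  directed : ∀ {x}, good x → ∀ j k, ∃ l, le x j l ∧ le x k l
  trans : ∀ {x}, good x → ∀ {i j k l}, i ∈ E x j k → i ∈ E x k l → i ∈ E x j l

/-- A finite set of requirements. -/
structure Cond (I : Type u) (W : Type u) (X : Type u) where
  dom : Finset X
  val : X → I
  bs : Finset W
  rg : Finset I

namespace Scheme

variable {I W X : Type u} [LinearOrder W] [LinearOrder X] (F : Scheme I W X)

/-- The set of points which satisfy the requirements of `p` at the stages before `x`. -/
def sat (p : Cond I W X) (x : WithTop X) : Set I :=
  {i | StrictMonoOn (F.q i) p.bs ∧ p.rg ⊆ F.u i ∧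
    ∀ y ∈ p.dom, (y : WithTop X) < x → i ∈ F.E y (p.val y) (F.h y i)}

variable {F}

theorem sat_anti (p : Cond I W X) {x y : WithTop X} (h : x ≤ y) : F.sat p y ⊆ F.sat p x :=
  fun _ hi => ⟨hi.1, hi.2.1, fun z hz hzx => hi.2.2 z hz (hzx.trans_le h)⟩

/-- Replace the requirements of `e` at and after stage `x` by those of `p` after `x` and the
requirement `l` at `x`. -/
def _root_.Cond.glue (e p : Cond I W X) (x : X) (l : I) : Cond I W X where
  dom := e.dom.filter (· < x) ∪ {x} ∪ p.dom.filter (x < ·)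
  val y := if y < x then e.val y else if y = x then l else p.val y
  bs := e.bs
  rg := e.rg

theorem sat_glue_of_le (e p : Cond I W X) (x : X) (l : I) {y : WithTop X} (hy : y ≤ x) :
    F.sat (Cond.glue e p x l) y = F.sat e y := by
  ext i
  refine and_congr Iff.rfl (and_congr Iff.rfl ⟨fun H z hz hzy => ?_, fun H z hz hzy => ?_⟩)
  · have hzx : z < x := WithTop.coe_lt_coe.1 (hzy.trans_le hy)
    have := H z (by simp [Cond.glue, hz, hzx]) hzy
    simpa [Cond.glue, hzx] using this
  · have hzx : z < x := WithTop.coe_lt_coe.1 (hzy.trans_le hy)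
    have hz' : z ∈ e.dom := by
      simp only [Cond.glue, Finset.mem_union, Finset.mem_filter, Finset.mem_singleton] at hz
      rcases hz with (hz | hz) | hz
      · exact hz.1
      · exact absurd hz hzx.ne
      · exact absurd hz.2 hzx.not_gt
    simpa [Cond.glue, hzx] using H z hz' hzy

theorem sat_glue_subset (e p : Cond I W X) (x : X) (l : I) {y : WithTop X} (hy : x < y) :
    F.sat (Cond.glue e p x l) y ⊆ F.sat e x ∩ {i | i ∈ F.E x l (F.h x i)} ∩
      {i | ∀ z ∈ p.dom, x < z → (z : WithTop X) < y → i ∈ F.E z (p.val z) (F.h z i)} := by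
  intro i hi
  refine ⟨⟨?_, ?_⟩, ?_⟩
  · rw [← sat_glue_of_le (F := F) e p x l le_rfl]
    exact sat_anti _ hy.le hi
  · simpa [Cond.glue] using hi.2.2 x (by simp [Cond.glue]) hy
  · intro z hz hxz hzy
    have := hi.2.2 z (by simp [Cond.glue, hz, hxz]) hzy
    simpa [Cond.glue, hxz.not_gt, hxz.ne'] using this

variable (F)

/-- The stages at which the construction acts: the sets `E x j k` with `le x j k` are in the
filter generated so far. -/
def Legit [WellFoundedLT X] (x : X) : Prop :=
  -- This spells out membership in the filter generated before `x`, using only stages below `x` so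
  -- that the recursion descends; `legit_iff` restates it through `Mem`.
  F.good x ∧ ∀ j k, F.le x j k → ∃ p : Cond I W X, ∃ hp : ∀ z ∈ p.dom, z < x,
    (∀ z (hz : z ∈ p.dom), Legit z ∧ F.sat p z ⊆ F.E z (p.val z) (p.val z)) ∧
      F.sat p ⊤ ⊆ F.E x j k
termination_by wellFounded_lt.wrap x
decreasing_by exact hp z hz

variable [WellFoundedLT X]

/-- All stages of `p` are legitimate, and earlier requirements make the later ones satisfiable. -/
def Closed (p : Cond I W X) : Prop :=
  ∀ z ∈ p.dom, F.Legit z ∧ F.sat p z ⊆ F.E z (p.val z) (p.val z)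

/-- The sets in the filter generated before stage `x`. -/
def Mem (x : WithTop X) (A : Set I) : Prop :=
  ∃ p, F.Closed p ∧ F.sat p x ⊆ A

variable {F}

theorem Mem.mono {x : WithTop X} {A B : Set I} (hA : F.Mem x A) (h : A ⊆ B) : F.Mem x B :=
  let ⟨p, hp, hpA⟩ := hA
  ⟨p, hp, hpA.trans h⟩

theorem Closed.mem {p : Cond I W X} (hp : F.Closed p) (x : WithTop X) : F.Mem x (F.sat p x) :=
  ⟨p, hp, subset_rfl⟩

theorem Closed.closed_glue {e p : Cond I W X} (he : F.Closed e) {x : X} {l : I} (hx : F.Legit x)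
    (hl : F.sat e x ⊆ F.E x l l)
    (hp : ∀ z ∈ p.dom, x < z → F.Legit z ∧
      F.sat (Cond.glue e p x l) z ⊆ F.E z (p.val z) (p.val z)) :
    F.Closed (Cond.glue e p x l) := by
  intro z hz
  rcases lt_trichotomy z x with h | rfl | h
  · have hz' : z ∈ e.dom := by
      simp only [Cond.glue, Finset.mem_union, Finset.mem_filter, Finset.mem_singleton] at hz
      rcases hz with (hz | hz) | hz
      · exact hz.1
      · exact absurd hz h.ne
      · exact absurd hz.2 h.not_gt
    rw [sat_glue_of_le e p x l (WithTop.coe_le_coe.2 h.le)]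
    simpa [Cond.glue, h] using he z hz'
  · rw [sat_glue_of_le e p z l le_rfl]
    simpa [Cond.glue] using ⟨hx, hl⟩
  · have hz' : z ∈ p.dom := by
      simp only [Cond.glue, Finset.mem_union, Finset.mem_filter, Finset.mem_singleton] at hz
      rcases hz with (hz | hz) | hz
      · exact absurd hz.2 h.not_gt
      · exact absurd hz h.ne'
      · exact hz.1
    simpa [Cond.glue, h.not_gt, h.ne'] using hp z hz' h

/-- The condition without requirements. -/
noncomputable def trivialCond [Nonempty I] : Cond I W X := ⟨∅, fun _ => Classical.arbitrary I, ∅, ∅⟩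

theorem Closed.restrict {p : Cond I W X} (hp : F.Closed p) (x : X) :
    F.Closed { p with dom := p.dom.filter (· < x) } ∧
    ∀ y : WithTop X, F.sat { p with dom := p.dom.filter (· < x) } y = F.sat p (min x y) := by
  have h : ∀ y : WithTop X,
      F.sat { p with dom := p.dom.filter (· < x) } y = F.sat p (min x y) := by
    intro y
    ext i
    simp [sat]
  refine ⟨fun z hz => ?_, h⟩
  rw [h]
  simp only [Finset.mem_filter] at hz
  rw [min_eq_right (WithTop.coe_le_coe.2 hz.2.le)]
  exact hp z hz.1

theorem legit_iff {x : X} :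
    F.Legit x ↔ F.good x ∧ ∀ j k, F.le x j k → F.Mem x (F.E x j k) := by
  rw [Legit]
  refine and_congr Iff.rfl (forall_congr' fun j => forall_congr' fun k => imp_congr Iff.rfl ?_)
  constructor
  · rintro ⟨p, hp, hc, hE⟩
    refine ⟨p, hc, fun i hi => hE ⟨hi.1, hi.2.1, fun y hy _ => ?_⟩⟩
    exact hi.2.2 y hy (WithTop.coe_lt_coe.2 (hp y hy))
  · rintro ⟨p, hc, hE⟩
    obtain ⟨h1, h2⟩ := hc.restrict x
    refine ⟨_, fun z hz => (by simpa using hz : z ∈ p.dom ∧ z < x).2, h1, ?_⟩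
    rw [h2, min_eq_left le_top]
    exact hE

theorem Mem.step [Nonempty I] {x : X} {y : WithTop X} (hxy : x < y) (hx : F.Legit x) {A : Set I}
    {l : I} (hA : F.Mem x A) (hl : A ⊆ F.E x l l) : F.Mem y (A ∩ {i | i ∈ F.E x l (F.h x i)}) := by
  obtain ⟨e, he, heA⟩ := hA
  exact ⟨Cond.glue e trivialCond x l, he.closed_glue hx (heA.trans hl) (by simp [trivialCond]), fun i hi =>
    ⟨heA (sat_glue_subset e _ x l hxy hi).1.1, (sat_glue_subset e _ x l hxy hi).1.2⟩⟩

/-- Two conditions may ask for different values at a common stage. At the last stage `y` before `x`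
that either mentions, both values are raised to a common upper bound `l`. The sets needed for this
lie in the filter generated before `y`, and transitivity of `E` returns both original requirements.
-/
theorem Mem.inter [Nonempty I] {x : WithTop X} {A B : Set I} (hA : F.Mem x A) (hB : F.Mem x B) :
    F.Mem x (A ∩ B) := by
  classical
  induction x using WellFoundedLT.induction generalizing A B with
  | ind x ih =>
  obtain ⟨p, hp, hpA⟩ := hA
  obtain ⟨e, he, heB⟩ := hB
  suffices F.Mem x (F.sat p x ∩ F.sat e x) from this.mono (Set.inter_subset_inter hpA heB)
  by_cases hne : ((p.dom ∪ e.dom).filter fun y : X => (y : WithTop X) < x).Nonempty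
  · obtain ⟨y, hy, hmax⟩ := Finset.exists_max_image _ id hne
    simp only [Finset.mem_filter, Finset.mem_union, id] at hy hmax
    obtain ⟨hy, hyx⟩ := hy
    have key : ∀ p : Cond I W X, ∀ i, i ∈ F.sat p y → (∀ z ∈ p.dom, (z : WithTop X) < x → z ≤ y) →
        (y ∈ p.dom → i ∈ F.E y (p.val y) (F.h y i)) → i ∈ F.sat p x := by
      intro p i hi hm hy
      refine ⟨hi.1, hi.2.1, fun z hz hzx => ?_⟩
      rcases (hm z hz hzx).lt_or_eq with h | rfl
      · exact hi.2.2 z hz (WithTop.coe_lt_coe.2 h)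
      · exact hy hz
    have hly : F.Legit y := by
      rcases hy with h | h
      · exact (hp y h).1
      · exact (he y h).1
    obtain ⟨hg, hE⟩ := legit_iff.1 hly
    obtain ⟨l, hl1, hl2⟩ := F.directed hg (p.val y) (e.val y)
    have hm := ih y hyx (ih y hyx (hp.mem y) (he.mem y))
      (ih y hyx (hE l l (F.le_refl hg l)) (ih y hyx (hE _ _ hl1) (hE _ _ hl2)))
    refine (hm.step hyx hly (l := l) fun i hi => hi.2.1).mono fun i hi => ?_
    obtain ⟨⟨⟨h1, h2⟩, h3, h4, h5⟩, h6⟩ := hi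
    refine ⟨key p i h1 (fun z hz hzx => hmax z ⟨Or.inl hz, hzx⟩)
      fun _ => F.trans hg h4 h6, ?_⟩
    exact key e i h2 (fun z hz hzx => hmax z ⟨Or.inr hz, hzx⟩)
      fun _ => F.trans hg h5 h6
  · rw [Finset.not_nonempty_iff_eq_empty, Finset.filter_eq_empty_iff] at hne
    refine ⟨⟨∅, p.val, p.bs ∪ e.bs, p.rg ∪ e.rg⟩, by simp [Closed], fun i hi => ⟨?_, ?_⟩⟩
    · exact ⟨hi.1.mono (by simp), Finset.union_subset_left hi.2.1,
        fun y hy hyx => absurd hyx (hne (by simp [hy]))⟩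
    · exact ⟨hi.1.mono (by simp), Finset.union_subset_right hi.2.1,
        fun y hy hyx => absurd hyx (hne (by simp [hy]))⟩

/-- A closed condition can be strengthened at stage `x`, without changing it later. -/
theorem Closed.exists_raise [Nonempty I] {p : Cond I W X} (hp : F.Closed p) {x : X}
    (hx : x ∈ p.dom) {l : I} (hl : F.le x (p.val x) l) {A : Set I} (hA : F.Mem x A) :
    ∃ p' : Cond I W X, F.Closed p' ∧ x ∈ p'.dom ∧ p'.val x = l ∧ F.sat p' x ⊆ A ∧
      (∀ y, x < y → (y ∈ p'.dom ↔ y ∈ p.dom) ∧ p'.val y = p.val y) ∧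
      ∀ y : WithTop X, x < y → F.sat p' y ⊆ F.sat p y := by
  have hlx := (hp x hx).1
  obtain ⟨hg, hE⟩ := legit_iff.1 hlx
  -- Below `x` the condition is replaced by some `e` that implies its old requirements there, `A`,
  -- and the relations `E x (p.val x) l` and `E x l l`; by transitivity the new requirement at `x`
  -- then implies the old one.
  obtain ⟨e, he, hesub⟩ := ((hp.mem x).inter hA).inter
    ((hE _ _ hl).inter (hE l l (F.le_refl hg l)))
  have hsub : ∀ y : WithTop X, x < y → F.sat (Cond.glue e p x l) y ⊆ F.sat p y := by
    intro y hy i hi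
    obtain ⟨⟨h1, h2⟩, h3⟩ := sat_glue_subset e p x l hy hi
    have h4 := hesub h1
    refine ⟨h4.1.1.1, h4.1.1.2.1, fun z hz hzy => ?_⟩
    rcases lt_trichotomy z x with h | rfl | h
    · exact h4.1.1.2.2 z hz (WithTop.coe_lt_coe.2 h)
    · exact F.trans hg h4.2.1 h2
    · exact h3 z hz h hzy
  refine ⟨Cond.glue e p x l, ?_, by simp [Cond.glue], by simp [Cond.glue], ?_, ?_, hsub⟩
  · exact he.closed_glue hlx (hesub.trans fun i hi => hi.2.2) fun z hz hxz =>
      ⟨(hp z hz).1, (hsub z (WithTop.coe_lt_coe.2 hxz)).trans (hp z hz).2⟩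
  · rw [sat_glue_of_le e p x l le_rfl]
    exact hesub.trans fun i hi => hi.1.2
  · intro y hy
    simp [Cond.glue, hy, hy.not_gt, hy.ne']

end Scheme

/-! ### Thinning out two families of conditions until they are compatible. -/

namespace Scheme

variable {I W X : Type u} [LinearOrder W] [LinearOrder X] {F : Scheme I W X}

/-- The requirements of `p` and `q` at stage `x` can be met together. -/
def Compat (F : Scheme I W X) (x : X) (p q : Cond I W X) : Prop :=
  F.sat p x ∩ F.sat q x ⊆ F.E x (p.val x) (q.val x) ∨
    F.sat p x ∩ F.sat q x ⊆ F.E x (q.val x) (p.val x)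

theorem Compat.symm {x : X} {p q : Cond I W X} (h : F.Compat x p q) : F.Compat x q p := by
  unfold Compat at h ⊢
  rw [Set.inter_comm, or_comm]
  exact h

variable {Θ₁ Θ₂ : Type u}

/-- Stage `x` is settled for two families of conditions: either it occurs rarely in the second
family, or the requirements at `x` from the two families are compatible. -/
def Settled (F : Scheme I W X) (S₁ : Set Θ₁) (S₂ : Set Θ₂) (p : Θ₁ → Cond I W X)
    (q : Θ₂ → Cond I W X) (x : X) : Prop :=
  ¬ Large {ζ ∈ S₂ | x ∈ (q ζ).dom} ∨
    ∀ ξ ∈ S₁, ∀ ζ ∈ S₂, x ∈ (p ξ).dom → x ∈ (q ζ).dom → F.Compat x (p ξ) (q ζ)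

theorem Settled.of_subset {S₁ T₁ : Set Θ₁} {S₂ T₂ : Set Θ₂} {p : Θ₁ → Cond I W X}
    {q : Θ₂ → Cond I W X} {x : X} (h : F.Settled S₁ S₂ p q x) (h₁ : T₁ ⊆ S₁) (h₂ : T₂ ⊆ S₂) :
    F.Settled T₁ T₂ p q x := by
  rcases h with h | h
  · exact Or.inl fun hL => h (hL.mono fun ζ hζ => ⟨h₂ hζ.1, hζ.2⟩)
  · exact Or.inr fun ξ hξ ζ hζ => h ξ (h₁ hξ) ζ (h₂ hζ)

/-- `p'` agrees with `p` after stage `x`, and is stronger than `p` in total. -/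
def RefinesAt (F : Scheme I W X) (x : X) (p p' : Cond I W X) : Prop :=
  (∀ y, x < y → (y ∈ p'.dom ↔ y ∈ p.dom) ∧ p'.val y = p.val y) ∧
    ∀ y : WithTop X, x < y → F.sat p' y ⊆ F.sat p y

theorem RefinesAt.refl (x : X) (p : Cond I W X) : F.RefinesAt x p p :=
  ⟨fun _ _ => ⟨Iff.rfl, rfl⟩, fun _ _ => subset_rfl⟩

theorem Settled.refine {S₁ : Set Θ₁} {S₂ : Set Θ₂} {p p' : Θ₁ → Cond I W X}
    {q q' : Θ₂ → Cond I W X} {x y : X} (h : F.Settled S₁ S₂ p q y) (hxy : x < y)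
    (hp : ∀ ξ ∈ S₁, F.RefinesAt x (p ξ) (p' ξ)) (hq : ∀ ζ ∈ S₂, F.RefinesAt x (q ζ) (q' ζ)) :
    F.Settled S₁ S₂ p' q' y := by
  rcases h with h | h
  · refine Or.inl fun hL => h (hL.mono fun ζ hζ => ⟨hζ.1, ?_⟩)
    exact (((hq ζ hζ.1).1 y hxy).1).1 hζ.2
  · refine Or.inr fun ξ hξ ζ hζ hyp hyq => ?_
    have h1 := (hp ξ hξ).1 y hxy
    have h2 := (hq ζ hζ).1 y hxy
    have h3 := Set.inter_subset_inter ((hp ξ hξ).2 y (WithTop.coe_lt_coe.2 hxy))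
      ((hq ζ hζ).2 y (WithTop.coe_lt_coe.2 hxy))
    have h4 := h ξ hξ ζ hζ (h1.1.1 hyp) (h2.1.1 hyq)
    unfold Compat at h4 ⊢
    rw [h1.2, h2.2]
    exact h4.imp h3.trans h3.trans

variable [WellFoundedLT X] [Nonempty I]

/-- If `x` occurs in all conditions of two families and bounds maps from `Θ₁`, then the families
can be thinned out and strengthened so that the requirements at `x` become compatible. -/
theorem exists_compat_of_boundsMaps {S₁ : Set Θ₁} {S₂ : Set Θ₂} {p : Θ₁ → Cond I W X}
    {q : Θ₂ → Cond I W X} (hp : ∀ ξ ∈ S₁, F.Closed (p ξ)) (hq : ∀ ζ ∈ S₂, F.Closed (q ζ)) {x : X}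
    (hlx : F.Legit x) (hS₁ : Large S₁) (hxp : ∀ ξ ∈ S₁, x ∈ (p ξ).dom)
    (hxq : ∀ ζ ∈ S₂, x ∈ (q ζ).dom) (hB : BoundsMaps Θ₁ (F.le x)) :
    ∃ (T₁ : Set Θ₁) (p' : Θ₁ → Cond I W X) (q' : Θ₂ → Cond I W X), T₁ ⊆ S₁ ∧ Large T₁ ∧
      (∀ ξ ∈ T₁, F.Closed (p' ξ) ∧ F.RefinesAt x (p ξ) (p' ξ)) ∧
      (∀ ζ ∈ S₂, F.Closed (q' ζ) ∧ F.RefinesAt x (q ζ) (q' ζ)) ∧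
      ∀ ξ ∈ T₁, ∀ ζ ∈ S₂, F.Compat x (p' ξ) (q' ζ) := by
  classical
  obtain ⟨hg, hE⟩ := legit_iff.1 hlx
  -- One `j` bounds the values at `x` for a large set of `ξ`. The first family is raised to exactly
  -- `j` and the second above `j`, so every value of the second dominates every value of the first.
  obtain ⟨j, hj⟩ := hB S₁ hS₁ fun ξ => (p ξ).val x
  have h1 : ∀ ξ, ∃ p' : Cond I W X, (ξ ∈ S₁ ∧ F.le x ((p ξ).val x) j) →
      F.Closed p' ∧ F.RefinesAt x (p ξ) p' ∧ p'.val x = j := by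
    intro ξ
    by_cases h : ξ ∈ S₁ ∧ F.le x ((p ξ).val x) j
    · obtain ⟨p', h1, -, h2, -, h3, h4⟩ :=
        (hp ξ h.1).exists_raise (hxp ξ h.1) h.2 (hE j j (F.le_refl hg j))
      exact ⟨p', fun _ => ⟨h1, ⟨h3, h4⟩, h2⟩⟩
    · exact ⟨p ξ, fun h' => absurd h' h⟩
  have h2 : ∀ ζ, ∃ q' : Cond I W X, ζ ∈ S₂ →
      F.Closed q' ∧ F.RefinesAt x (q ζ) q' ∧ F.sat q' x ⊆ F.E x j (q'.val x) := by
    intro ζ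
    by_cases h : ζ ∈ S₂
    · obtain ⟨l, hl1, hl2⟩ := F.directed hg ((q ζ).val x) j
      obtain ⟨q', h1, -, h2, h5, h3, h4⟩ :=
        (hq ζ h).exists_raise (hxq ζ h) hl1 (hE _ _ hl2)
      exact ⟨q', fun _ => ⟨h1, ⟨h3, h4⟩, h2.symm ▸ h5⟩⟩
    · exact ⟨q ζ, fun h' => absurd h' h⟩
  choose p' hp' using h1
  choose q' hq' using h2
  refine ⟨_, p', q', fun ξ hξ => hξ.1, hj, fun ξ hξ => ⟨(hp' ξ hξ).1, (hp' ξ hξ).2.1⟩,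
    fun ζ hζ => ⟨(hq' ζ hζ).1, (hq' ζ hζ).2.1⟩, fun ξ hξ ζ hζ => Or.inl ?_⟩
  rw [(hp' ξ hξ).2.2]
  exact Set.inter_subset_right.trans (hq' ζ hζ).2.2

/-- Thinning leaves `x` rare in the second family, absent from the first, or present in all
conditions of both; the last case is handled by bounding maps. Conditions change only at and below
`x`, so the stages above stay settled. -/
theorem exists_settled_at (hΘ₁ : (#Θ₁).IsRegular) (hΘ₂ : (#Θ₂).IsRegular)
    (hgood : ∀ x, F.good x → BoundsMaps Θ₁ (F.le x) ∨ BoundsMaps Θ₂ (F.le x))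
    {S₁ : Set Θ₁} {S₂ : Set Θ₂} {p : Θ₁ → Cond I W X} {q : Θ₂ → Cond I W X}
    (hS₁ : Large S₁) (hS₂ : Large S₂) (hp : ∀ ξ ∈ S₁, F.Closed (p ξ))
    (hq : ∀ ζ ∈ S₂, F.Closed (q ζ)) {x : X} (hx : ∀ y, x < y → F.Settled S₁ S₂ p q y) :
    ∃ (T₁ : Set Θ₁) (T₂ : Set Θ₂) (p' : Θ₁ → Cond I W X) (q' : Θ₂ → Cond I W X),
      T₁ ⊆ S₁ ∧ T₂ ⊆ S₂ ∧ Large T₁ ∧ Large T₂ ∧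
      (∀ ξ ∈ T₁, F.Closed (p' ξ) ∧ F.RefinesAt x (p ξ) (p' ξ)) ∧
      (∀ ζ ∈ T₂, F.Closed (q' ζ) ∧ F.RefinesAt x (q ζ) (q' ζ)) ∧
      ∀ y, x ≤ y → F.Settled T₁ T₂ p' q' y := by
  classical
  by_cases h2 : Large {ζ ∈ S₂ | x ∈ (q ζ).dom}
  swap
  · refine ⟨S₁, S₂, p, q, subset_rfl, subset_rfl, hS₁, hS₂, fun ξ h => ⟨hp ξ h, .refl _ _⟩,
      fun ζ h => ⟨hq ζ h, .refl _ _⟩, fun y hy => ?_⟩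
    rcases hy.lt_or_eq with h | rfl
    · exact hx y h
    · exact Or.inl h2
  by_cases h1 : Large {ξ ∈ S₁ | x ∉ (p ξ).dom}
  · refine ⟨_, S₂, p, q, fun ξ hξ => hξ.1, subset_rfl, h1, hS₂, fun ξ h => ⟨hp ξ h.1, .refl _ _⟩,
      fun ζ h => ⟨hq ζ h, .refl _ _⟩, fun y hy => ?_⟩
    rcases hy.lt_or_eq with h | rfl
    · exact (hx y h).of_subset (fun ξ hξ => hξ.1) subset_rfl
    · exact Or.inr fun ξ hξ _ _ h => absurd h hξ.2
  have h1' : Large {ξ ∈ S₁ | x ∈ (p ξ).dom} :=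
    (hS₁.diff hΘ₁ h1).mono fun ξ hξ => ⟨hξ.1, by_contra fun h => hξ.2 ⟨hξ.1, h⟩⟩
  obtain ⟨ζ₀, hζ₀, hζ₀x⟩ := h2.nonempty hΘ₂
  have hlx := (hq ζ₀ hζ₀ x hζ₀x).1
  rcases hgood x (legit_iff.1 hlx).1 with hB | hB
  · obtain ⟨T₁, p', q', hT, hTL, hp', hq', hc⟩ := exists_compat_of_boundsMaps
      (fun ξ hξ => hp ξ hξ.1) (fun ζ hζ => hq ζ hζ.1) hlx h1' (fun ξ hξ => hξ.2)
      (fun ζ (hζ : ζ ∈ {ζ ∈ S₂ | x ∈ (q ζ).dom}) => hζ.2) hB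
    refine ⟨T₁, _, p', q', fun ξ hξ => (hT hξ).1, fun ζ hζ => hζ.1, hTL, h2, hp', hq',
      fun y hy => ?_⟩
    rcases hy.lt_or_eq with h | rfl
    · exact ((hx y h).of_subset (fun ξ hξ => (hT hξ).1) fun ζ hζ => hζ.1).refine h
        (fun ξ hξ => (hp' ξ hξ).2) fun ζ hζ => (hq' ζ hζ).2
    · exact Or.inr fun ξ hξ ζ hζ _ _ => hc ξ hξ ζ hζ
  · obtain ⟨T₂, q', p', hT, hTL, hq', hp', hc⟩ := exists_compat_of_boundsMaps
      (fun ζ hζ => hq ζ hζ.1) (fun ξ hξ => hp ξ hξ.1) hlx h2 (fun ζ hζ => hζ.2)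
      (fun ξ (hξ : ξ ∈ {ξ ∈ S₁ | x ∈ (p ξ).dom}) => hξ.2) hB
    refine ⟨_, T₂, p', q', fun ξ hξ => hξ.1, fun ζ hζ => (hT hζ).1, h1', hTL, hp', hq',
      fun y hy => ?_⟩
    rcases hy.lt_or_eq with h | rfl
    · exact ((hx y h).of_subset (fun ξ hξ => hξ.1) fun ζ hζ => (hT hζ).1).refine h
        (fun ξ hξ => (hp' ξ hξ).2) fun ζ hζ => (hq' ζ hζ).2
    · exact Or.inr fun ξ hξ ζ hζ _ _ => (hc ζ hζ ξ hξ).symm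

/-- Outside a finite root every stage is rare in the second family, so only root stages need work.
The largest one below `x` is settled next. This may create new stages below it and hence a new root,
but the stage reached goes down each time, so well-foundedness ends the process. -/
theorem exists_settled (hΘ₁ : (#Θ₁).IsRegular) (hΘ₂ : (#Θ₂).IsRegular) (hω : ℵ₀ < #Θ₂)
    (hgood : ∀ x, F.good x → BoundsMaps Θ₁ (F.le x) ∨ BoundsMaps Θ₂ (F.le x)) (x : WithTop X)
    {S₁ : Set Θ₁} {S₂ : Set Θ₂} {p : Θ₁ → Cond I W X} {q : Θ₂ → Cond I W X}
    (hS₁ : Large S₁) (hS₂ : Large S₂) (hp : ∀ ξ ∈ S₁, F.Closed (p ξ))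
    (hq : ∀ ζ ∈ S₂, F.Closed (q ζ)) (hx : ∀ y : X, x ≤ y → F.Settled S₁ S₂ p q y) :
    ∃ (T₁ : Set Θ₁) (T₂ : Set Θ₂) (p' : Θ₁ → Cond I W X) (q' : Θ₂ → Cond I W X),
      T₁ ⊆ S₁ ∧ T₂ ⊆ S₂ ∧ Large T₁ ∧ Large T₂ ∧
      (∀ ξ ∈ T₁, F.Closed (p' ξ) ∧ F.sat (p' ξ) ⊤ ⊆ F.sat (p ξ) ⊤) ∧
      (∀ ζ ∈ T₂, F.Closed (q' ζ) ∧ F.sat (q' ζ) ⊤ ⊆ F.sat (q ζ) ⊤) ∧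
      ∀ y, F.Settled T₁ T₂ p' q' y := by
  classical
  induction x using WellFoundedLT.induction generalizing S₁ S₂ p q with
  | ind x ih =>
  obtain ⟨S, r, hS, hSL, hr⟩ := hS₂.exists_root hΘ₂ hω fun ζ => (q ζ).dom
  by_cases hne : (r.filter fun y : X => (y : WithTop X) < x).Nonempty
  · obtain ⟨z, hz, hmax⟩ := Finset.exists_max_image _ id hne
    simp only [Finset.mem_filter, id] at hz hmax
    have hset : ∀ y, z < y → F.Settled S₁ S p q y := by
      intro y hzy
      by_cases hyr : y ∈ r
      · refine (hx y ?_).of_subset subset_rfl hS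
        by_contra hcon
        exact (hmax y ⟨hyr, not_le.1 hcon⟩).not_gt hzy
      · exact Or.inl (hr y hyr)
    obtain ⟨T₁, T₂, p', q', h1, h2, h3, h4, h5, h6, h7⟩ :=
      exists_settled_at hΘ₁ hΘ₂ hgood hS₁ hSL hp (fun ζ hζ => hq ζ (hS hζ)) hset
    obtain ⟨T₁', T₂', p'', q'', k0, k0', k1, k2, k3, k4, k5⟩ := ih z hz.2 h3 h4 (fun ξ hξ => (h5 ξ hξ).1)
      (fun ζ hζ => (h6 ζ hζ).1) fun y hy => h7 y (WithTop.coe_le_coe.1 hy)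
    have hzt : (z : WithTop X) < ⊤ := WithTop.coe_lt_top z
    exact ⟨T₁', T₂', p'', q'', k0.trans h1, (k0'.trans h2).trans hS, k1, k2,
      fun ξ hξ => ⟨(k3 ξ hξ).1, (k3 ξ hξ).2.trans ((h5 ξ (k0 hξ)).2.2 ⊤ hzt)⟩,
      fun ζ hζ => ⟨(k4 ζ hζ).1, (k4 ζ hζ).2.trans ((h6 ζ (k0' hζ)).2.2 ⊤ hzt)⟩, k5⟩
  · refine ⟨S₁, S, p, q, subset_rfl, hS, hS₁, hSL, fun ξ hξ => ⟨hp ξ hξ, subset_rfl⟩,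
      fun ζ hζ => ⟨hq ζ (hS hζ), subset_rfl⟩, fun y => ?_⟩
    by_cases hyr : y ∈ r
    · refine (hx y ?_).of_subset subset_rfl hS
      by_contra hcon
      exact hne ⟨y, by simpa [hyr] using hcon⟩
    · exact Or.inl (hr y hyr)

end Scheme

namespace Scheme

variable {I W X : Type u} [LinearOrder W] [LinearOrder X] {F : Scheme I W X}
  {Θ₁ Θ₂ : Type u} [WellFoundedLT X] [Nonempty I]

/-- After settling, a root is taken for the chain elements of the second family. First `ξ` is chosen
to avoid `R₁` on the root; then `ζ` avoids `R₂` on the root and every collision with `p' ξ` outside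
the root or at a rare stage. Only the second family needs a `Δ`-system, so one uncountable cardinal
suffices. -/
theorem exists_compat_pair_of_uncountable (hΘ₁ : (#Θ₁).IsRegular) (hΘ₂ : (#Θ₂).IsRegular)
    (hω : ℵ₀ < #Θ₂)
    (hgood : ∀ x, F.good x → BoundsMaps Θ₁ (F.le x) ∨ BoundsMaps Θ₂ (F.le x))
    {p : Θ₁ → Cond I W X} {q : Θ₂ → Cond I W X} (hp : ∀ ξ, F.Closed (p ξ))
    (hq : ∀ ζ, F.Closed (q ζ)) (f : Θ₁ → W) (g : Θ₂ → W)
    {R₁ : Θ₁ → W → Prop} {R₂ : Θ₂ → W → Prop} (hR₁ : ∀ w, ¬ Large {ξ | R₁ ξ w})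
    (hR₂ : ∀ w, ¬ Large {ζ | R₂ ζ w}) :
    ∃ ξ ζ p' q', F.Closed p' ∧ F.Closed q' ∧ F.sat p' ⊤ ⊆ F.sat (p ξ) ⊤ ∧
      F.sat q' ⊤ ⊆ F.sat (q ζ) ⊤ ∧ (∀ y ∈ p'.dom, y ∈ q'.dom → F.Compat y p' q') ∧
      ∀ w, (w = f ξ ∨ w ∈ p'.bs) → (w = g ζ ∨ w ∈ q'.bs) → ¬ R₁ ξ w ∧ ¬ R₂ ζ w := by
  classical
  obtain ⟨T₁, T₂, p', q', -, -, hT₁, hT₂, hp', hq', hset⟩ :=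
    exists_settled hΘ₁ hΘ₂ hω hgood ⊤ large_univ large_univ (fun ξ _ => hp ξ) (fun ζ _ => hq ζ)
      (fun y hy => absurd hy (not_le.2 (WithTop.coe_lt_top y)))
  obtain ⟨S, r, hS, hSL, hr⟩ := hT₂.exists_root hΘ₂ hω fun ζ => insert (g ζ) (q' ζ).bs
  obtain ⟨ξ, hξ, hξr⟩ := (hT₁.diff_biUnion hΘ₁ r (fun w => {ξ | R₁ ξ w})
    fun w _ => hR₁ w).nonempty hΘ₁
  -- the indices in the second family that may collide with `p' ξ`
  have h1 := hSL.diff_biUnion hΘ₂ r (fun w => {ζ | R₂ ζ w}) fun w _ => hR₂ w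
  have h2 := h1.diff_biUnion hΘ₂ ((insert (f ξ) (p' ξ).bs).filter (· ∉ r))
    (fun w => {ζ ∈ S | w ∈ insert (g ζ) (q' ζ).bs}) fun w hw => hr w (Finset.mem_filter.1 hw).2
  have h3 := h2.diff_biUnion hΘ₂
    ((p' ξ).dom.filter fun y => ¬ Large {ζ ∈ T₂ | y ∈ (q' ζ).dom})
    (fun y => {ζ ∈ T₂ | y ∈ (q' ζ).dom}) fun y hy => (Finset.mem_filter.1 hy).2
  obtain ⟨ζ, ⟨⟨hζS, hζ1⟩, hζ2⟩, hζ3⟩ := h3.nonempty hΘ₂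
  refine ⟨ξ, ζ, p' ξ, q' ζ, (hp' ξ hξ).1, (hq' ζ (hS hζS)).1, (hp' ξ hξ).2, (hq' ζ (hS hζS)).2,
    fun y hy hy' => ?_, fun w hw hw' => ?_⟩
  · rcases hset y with h | h
    · exact absurd ⟨hS hζS, hy'⟩ (hζ3 y (Finset.mem_filter.2 ⟨hy, h⟩))
    · exact h ξ hξ ζ (hS hζS) hy hy'
  · have hwr : w ∈ r := by
      by_contra hcon
      exact hζ2 w (Finset.mem_filter.2 ⟨Finset.mem_insert.2 hw, hcon⟩)
        ⟨hζS, Finset.mem_insert.2 hw'⟩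
    exact ⟨hξr w hwr, hζ1 w hwr⟩

theorem exists_compat_pair (hΘ₁ : (#Θ₁).IsRegular) (hΘ₂ : (#Θ₂).IsRegular)
    (hω : ℵ₀ < #Θ₁ ∨ ℵ₀ < #Θ₂)
    (hgood : ∀ x, F.good x → BoundsMaps Θ₁ (F.le x) ∨ BoundsMaps Θ₂ (F.le x))
    {p : Θ₁ → Cond I W X} {q : Θ₂ → Cond I W X} (hp : ∀ ξ, F.Closed (p ξ))
    (hq : ∀ ζ, F.Closed (q ζ)) (f : Θ₁ → W) (g : Θ₂ → W)
    {R₁ : Θ₁ → W → Prop} {R₂ : Θ₂ → W → Prop} (hR₁ : ∀ w, ¬ Large {ξ | R₁ ξ w})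
    (hR₂ : ∀ w, ¬ Large {ζ | R₂ ζ w}) :
    ∃ ξ ζ p' q', F.Closed p' ∧ F.Closed q' ∧ F.sat p' ⊤ ⊆ F.sat (p ξ) ⊤ ∧
      F.sat q' ⊤ ⊆ F.sat (q ζ) ⊤ ∧ (∀ y ∈ p'.dom, y ∈ q'.dom → F.Compat y p' q') ∧
      ∀ w, (w = f ξ ∨ w ∈ p'.bs) → (w = g ζ ∨ w ∈ q'.bs) → ¬ R₁ ξ w ∧ ¬ R₂ ζ w := by
  rcases hω with hω | hω
  · obtain ⟨ζ, ξ, q', p', h1, h2, h3, h4, h5, h6⟩ := exists_compat_pair_of_uncountable hΘ₂ hΘ₁ hω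
      (fun x hx => (hgood x hx).symm) hq hp g f hR₂ hR₁
    exact ⟨ξ, ζ, p', q', h2, h1, h4, h3, fun y hy hy' => (h5 y hy' hy).symm,
      fun w hw hw' => (h6 w hw' hw).symm⟩
  · exact exists_compat_pair_of_uncountable hΘ₁ hΘ₂ hω hgood hp hq f g hR₁ hR₂

end Scheme

/-! ### Amalgamation of finite chains and the unfilled middle of the generic chain. -/

/-- Two finite chains which agree on their intersection can be amalgamated so that a given
element `g` of the second one lies below a given element `f` of the first one, unless the
intersection separates them. -/
theorem exists_amalgam {W : Type u} [LinearOrder W] (b c : Finset W) {f g : W} (hf : f ∈ b)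
    (hg : g ∈ c) (h : ∀ w ∈ b, w ∈ c → (w < f ∧ w < g) ∨ (f < w ∧ g < w)) :
    ∃ r : W → ℚ, StrictMonoOn r b ∧ StrictMonoOn r c ∧ r g < r f := by
  classical
  -- Elements are sorted by the number of common elements below them. Within one gap those only in
  -- `c` come before those only in `b`, and the common element closing the gap comes last. By `h`,
  -- `f` and `g` lie in the same gap, so `g` precedes `f`.
  let N : W → ℕ := fun w => ((b ∩ c).filter (· < w)).card
  let tag : W → ℕ := fun w => if w ∈ b ∩ c then 2 else if w ∈ b then 1 else 0
  let key : W → ℕ ×ₗ (ℕ ×ₗ W) := fun w => toLex (N w, toLex (tag w, w))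
  let r : W → ℚ := fun w => (((b ∪ c).filter fun v => key v < key w).card : ℚ)
  have hr : ∀ v ∈ b ∪ c, ∀ w, key v < key w → r v < r w := by
    intro v hv w hvw
    refine Nat.cast_lt.2 (Finset.card_lt_card ⟨?_, ?_⟩)
    · intro z hz
      simp only [Finset.mem_filter] at hz ⊢
      exact ⟨hz.1, hz.2.trans hvw⟩
    · intro hsub
      have := hsub (Finset.mem_filter.2 ⟨hv, hvw⟩)
      exact lt_irrefl _ (Finset.mem_filter.1 this).2
  have hN : ∀ v w, v < w → N v ≤ N w ∧ (v ∈ b ∩ c → N v < N w) := by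
    intro v w hvw
    have hsub : (b ∩ c).filter (· < v) ⊆ (b ∩ c).filter (· < w) := by
      intro z hz
      simp only [Finset.mem_filter] at hz ⊢
      exact ⟨hz.1, hz.2.trans hvw⟩
    refine ⟨Finset.card_le_card hsub, fun hv => Finset.card_lt_card ⟨hsub, fun h' => ?_⟩⟩
    have := h' (Finset.mem_filter.2 ⟨hv, hvw⟩)
    exact lt_irrefl _ (Finset.mem_filter.1 this).2
  have hkey : ∀ v w, v < w → (v ∉ b ∩ c → tag v ≤ tag w) → key v < key w := by
    intro v w hvw htag
    rw [Prod.Lex.toLex_lt_toLex]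
    by_cases hv : v ∈ b ∩ c
    · exact Or.inl ((hN v w hvw).2 hv)
    · rcases (hN v w hvw).1.lt_or_eq with h1 | h1
      · exact Or.inl h1
      · refine Or.inr ⟨h1, ?_⟩
        rw [Prod.Lex.toLex_lt_toLex]
        rcases (htag hv).lt_or_eq with h2 | h2
        · exact Or.inl h2
        · exact Or.inr ⟨h2, hvw⟩
  refine ⟨r, fun v hv w hw hvw => ?_, fun v hv w hw hvw => ?_, ?_⟩
  · have hv' : v ∈ b := hv
    have hw' : w ∈ b := hw
    refine hr v (by simp [hv']) w (hkey v w hvw fun hbc => ?_)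
    simp only [tag, if_neg hbc, if_pos hv', if_pos hw']
    split_ifs <;> omega
  · have hv' : v ∈ c := hv
    have hw' : w ∈ c := hw
    refine hr v (by simp [hv']) w (hkey v w hvw fun hbc => ?_)
    have hvb : v ∉ b := fun h => hbc (Finset.mem_inter.2 ⟨h, hv'⟩)
    simp [tag, hvb]
  · have hfc : f ∉ c := fun h' => by
      rcases h f hf h' with h1 | h1
      · exact lt_irrefl _ h1.1
      · exact lt_irrefl _ h1.1
    have hgb : g ∉ b := fun h' => by
      rcases h g h' hg with h1 | h1
      · exact lt_irrefl _ h1.2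
      · exact lt_irrefl _ h1.2
    refine hr g (by simp [hg]) f ?_
    rw [Prod.Lex.toLex_lt_toLex]
    refine Or.inr ⟨?_, ?_⟩
    · refine congrArg Finset.card (Finset.filter_congr fun w hw => ?_)
      rw [Finset.mem_inter] at hw
      rcases h w hw.1 hw.2 with h1 | h1
      · exact ⟨fun _ => h1.1, fun _ => h1.2⟩
      · exact ⟨fun h' => absurd h' h1.2.not_gt, fun h' => absurd h' h1.1.not_gt⟩
    · rw [Prod.Lex.toLex_lt_toLex]
      left
      simp [tag, hfc, hgb, hf]

namespace Scheme

variable {I W X : Type u} [LinearOrder W] [LinearOrder X] {F : Scheme I W X}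

/-- Finitely many values of the functions of the scheme can be prescribed. -/
def Independent (F : Scheme I W X) : Prop :=
  ∀ (D : Finset X) (v : X → I) (c : Finset I) (b : Finset W) (r : W → ℚ),
    ∃ i, (∀ x ∈ D, F.h x i = v x) ∧ c ⊆ F.u i ∧ ∀ w ∈ b, F.q i w = r w

variable [WellFoundedLT X]

/-- Independence provides an `i` at which each `h y` takes the dominating one of the two required
values. By induction on stages, closedness and compatibility show that this meets both sets of
requirements, while `q i` follows the amalgamated chain. -/
theorem exists_mem_sat_inter (hF : F.Independent) {p q : Cond I W X} (hp : F.Closed p)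
    (hq : F.Closed q) (hpq : ∀ y ∈ p.dom, y ∈ q.dom → F.Compat y p q) {f g : W}
    (h : ∀ w, (w = f ∨ w ∈ p.bs) → (w = g ∨ w ∈ q.bs) → (w < f ∧ w < g) ∨ (f < w ∧ g < w)) :
    ∃ i ∈ F.sat p ⊤ ∩ F.sat q ⊤, F.q i g < F.q i f := by
  classical
  obtain ⟨r, hr1, hr2, hr3⟩ := exists_amalgam (insert f p.bs) (insert g q.bs)
    (Finset.mem_insert_self _ _) (Finset.mem_insert_self _ _)
    fun w hw hw' => h w (Finset.mem_insert.1 hw) (Finset.mem_insert.1 hw')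
  obtain ⟨i, hi1, hi2, hi3⟩ := hF (p.dom ∪ q.dom)
    (fun y => if y ∈ p.dom ∧ (y ∈ q.dom → F.sat p y ∩ F.sat q y ⊆ F.E y (q.val y) (p.val y))
      then p.val y else q.val y) (p.rg ∪ q.rg) (insert f p.bs ∪ insert g q.bs) r
  have hmono : ∀ s : Finset W, s ⊆ insert f p.bs ∪ insert g q.bs → StrictMonoOn r s →
      StrictMonoOn (F.q i) s := by
    intro s hs hr v hv w hw hvw
    rw [hi3 v (hs hv), hi3 w (hs hw)]
    exact hr hv hw hvw
  have hsat : ∀ x : WithTop X, i ∈ F.sat p x ∧ i ∈ F.sat q x := by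
    intro x
    induction x using WellFoundedLT.induction with
    | ind x ih =>
    refine ⟨⟨?_, (Finset.union_subset_left hi2), fun y hy hyx => ?_⟩,
      ⟨?_, (Finset.union_subset_right hi2), fun y hy hyx => ?_⟩⟩
    · exact hmono _ ((Finset.subset_insert _ _).trans Finset.subset_union_left)
        (hr1.mono (by simp))
    · rw [hi1 y (by simp [hy])]
      split_ifs with hc
      · exact (hp y hy).2 (ih y hyx).1
      · push Not at hc
        obtain ⟨hyq, hn⟩ := hc hy
        exact (hpq y hy hyq).resolve_right hn (ih y hyx)
    · exact hmono _ ((Finset.subset_insert _ _).trans Finset.subset_union_right)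
        (hr2.mono (by simp))
    · rw [hi1 y (by simp [hy])]
      split_ifs with hc
      · exact hc.2 hy (ih y hyx)
      · exact (hq y hy).2 (ih y hyx).2
  refine ⟨i, hsat ⊤, ?_⟩
  rw [hi3 g (by simp), hi3 f (by simp)]
  exact hr3

/-- The filter generated by a scheme. -/
def filter [Nonempty I] (F : Scheme I W X) : Filter I where
  sets := {A | F.Mem ⊤ A}
  univ_sets := ⟨trivialCond, by simp [Closed, trivialCond], Set.subset_univ _⟩
  sets_of_superset h hsub := h.mono hsub
  inter_sets hA hB := hA.inter hB

theorem isRegularFilter_filter [Nonempty I] : IsRegularFilter F.filter :=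
  ⟨F.u, fun a => ⟨⟨∅, fun _ => a, ∅, {a}⟩, by simp [Closed], fun i hi => by simpa using hi.2.1⟩⟩

theorem eventually_lt [Nonempty I] {v w : W} (h : v < w) :
    ∀ᶠ i in F.filter, F.q i v < F.q i w :=
  ⟨⟨∅, fun _ => Classical.arbitrary I, {v, w}, ∅⟩, by simp [Closed],
    fun i hi => hi.1 (by simp) (by simp) h⟩

/-- The generic chain of type `Θ₁ + Θ₂ᵒᵈ` cannot be separated in the middle by members of the
filter. -/
theorem exists_mem_inter_lt {Θ₁ Θ₂ : Type u} [LinearOrder Θ₁] [LinearOrder Θ₂]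
    {F : Scheme I (Θ₁ ⊕ₗ Θ₂ᵒᵈ) X} [Nonempty I] (hF : F.Independent)
    (hΘ₁ : (#Θ₁).IsRegular) (hΘ₂ : (#Θ₂).IsRegular) (hω : ℵ₀ < #Θ₁ ∨ ℵ₀ < #Θ₂)
    (h₁ : ∀ ξ : Θ₁, #(Set.Iic ξ) < #Θ₁) (h₂ : ∀ ζ : Θ₂, #(Set.Iic ζ) < #Θ₂)
    (hgood : ∀ x, F.good x → BoundsMaps Θ₁ (F.le x) ∨ BoundsMaps Θ₂ (F.le x))
    {U : Θ₁ → Set I} {V : Θ₂ → Set I} (hU : ∀ ξ, U ξ ∈ F.filter) (hV : ∀ ζ, V ζ ∈ F.filter) :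
    ∃ ξ ζ, ∃ i ∈ U ξ ∩ V ζ,
      F.q i (Sum.inrₗ (OrderDual.toDual ζ)) < F.q i (Sum.inlₗ ξ) := by
  choose p hp hpU using hU
  choose q hq hqV using hV
  let f : Θ₁ → Θ₁ ⊕ₗ Θ₂ᵒᵈ := fun ξ => Sum.inlₗ ξ
  let g : Θ₂ → Θ₁ ⊕ₗ Θ₂ᵒᵈ := fun ζ => Sum.inrₗ (OrderDual.toDual ζ)
  -- An element of the left half excludes the `ξ` at or below it, and one of the right half excludes
  -- the `ζ` at or below it in `Θ₂`; these initial segments are small. Avoiding them puts each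
  -- common chain element on the same side of `f ξ` and `g ζ`.
  have hR₁ : ∀ w, ¬ Large {ξ | ∃ ξ', w = f ξ' ∧ ξ ≤ ξ'} := by
    intro w
    rcases w with ξ' | ζ'
    · refine fun hL => (hL.mono (T := Set.Iic ξ') ?_).not_gt (h₁ ξ')
      rintro ξ ⟨ξ'', h, h'⟩
      cases Sum.inl_injective (toLex.injective h)
      exact h'
    · refine fun hL => ?_
      obtain ⟨ξ, ξ'', h, -⟩ := hL.nonempty hΘ₁
      exact absurd (toLex.injective h) (by simp)
  have hR₂ : ∀ w, ¬ Large {ζ | ∃ ζ', w = g ζ' ∧ ζ ≤ ζ'} := by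
    intro w
    rcases w with ξ' | ζ'
    · refine fun hL => ?_
      obtain ⟨ξ, ξ'', h, -⟩ := hL.nonempty hΘ₂
      exact absurd (toLex.injective h) (by simp)
    · refine fun hL => (hL.mono (T := Set.Iic (OrderDual.ofDual ζ')) ?_).not_gt (h₂ _)
      rintro ζ ⟨ζ'', h, h'⟩
      cases Sum.inr_injective (toLex.injective h)
      exact h'
  obtain ⟨ξ, ζ, p', q', k1, k2, k3, k4, k5, k6⟩ :=
    exists_compat_pair hΘ₁ hΘ₂ hω hgood hp hq f g hR₁ hR₂
  obtain ⟨i, hi, hlt⟩ := exists_mem_sat_inter hF k1 k2 k5 (f := f ξ) (g := g ζ) (by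
    intro w hw hw'
    obtain ⟨h1, h2⟩ := k6 w hw hw'
    rcases w with ξ' | ζ'
    · left
      have : ξ' < ξ := not_le.1 fun h => h1 ⟨ξ', rfl, h⟩
      exact ⟨Sum.Lex.inl_lt_inl_iff.2 this, Sum.Lex.inl_lt_inr _ _⟩
    · right
      have : OrderDual.ofDual ζ' < ζ := not_le.1 fun h => h2 ⟨_, rfl, h⟩
      exact ⟨Sum.Lex.inl_lt_inr _ _, Sum.Lex.inr_lt_inr_iff.2 this⟩)
  exact ⟨ξ, ζ, i, ⟨hpU ξ (k3 hi.1), hqV ζ (k4 hi.2)⟩, hlt⟩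

end Scheme

/-! ### Bookkeeping: the generated filter solves all admitted problems. -/

theorem exists_gt_all_of_card_le {I K : Type u} [LinearOrder K] (hK : #I < Order.cof K)
    (hK' : (Order.cof K).IsRegular)
    (s : I → Finset K) : ∃ c, ∀ a, ∀ y ∈ s a, y < c := by
  have h : #(⋃ a, (s a : Set K)) < Order.cof K :=
    (card_iUnion_lt_iff_forall_of_isRegular hK' hK).2 fun a =>
      lt_of_lt_of_le (by simp) hK'.aleph0_le
  have h2 : ¬ IsCofinal (⋃ a, (s a : Set K)) := fun hc => (Order.cof_le hc).not_gt h
  obtain ⟨c, hc⟩ := not_isCofinal_iff.1 h2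
  exact ⟨c, fun a y hy => hc y (Set.mem_iUnion.2 ⟨a, hy⟩)⟩

namespace Scheme

/-- If every problem is treated cofinally often, then the filter generated by the scheme solves
every problem whose premises it contains. -/
theorem exists_solution {I W K R : Type u} [LinearOrder W] [LinearOrder K] [LinearOrder R]
    [WellFoundedLT K] [WellFoundedLT R] [Infinite I] (hK : #I < Order.cof K)
    (hK' : (Order.cof K).IsRegular) (F : Scheme I W (K ×ₗ R)) (ρ : R)
    (le : I → I → Prop) (E : I → I → Set I)
    (hρ : ∀ c, F.good (toLex (c, ρ)) ∧ F.le (toLex (c, ρ)) = le ∧ F.E (toLex (c, ρ)) = E)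
    (hle : ∀ j, le j j) (hE : ∀ j k, le j k → E j k ∈ F.filter) :
    ∃ h : I → I, ∀ j, {i | i ∈ E j (h i)} ∈ F.filter := by
  classical
  have hex : ∀ a : I × I, ∃ p, le a.1 a.2 → F.Closed p ∧ F.sat p ⊤ ⊆ E a.1 a.2 := by
    intro a
    by_cases h : le a.1 a.2
    · obtain ⟨p, hp⟩ := hE a.1 a.2 h
      exact ⟨p, fun _ => hp⟩
    · exact ⟨trivialCond, fun h' => absurd h' h⟩
  choose p hp using hex
  have hI : #(I × I) < Order.cof K := by
    rwa [mk_prod, lift_id, mul_eq_self (aleph0_le_mk I)]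
  -- There are at most `#I` premises, each witnessed by finitely many stages, so all of them lie
  -- before one `c`; at stage `(c, ρ)` the problem is legitimate.
  obtain ⟨c, hc⟩ := exists_gt_all_of_card_le hI hK'
    fun a => (p a).dom.image fun y => (ofLex y).1
  let x : K ×ₗ R := toLex (c, ρ)
  have hx : F.Legit x := by
    rw [legit_iff]
    refine ⟨(hρ c).1, fun j k hjk => ?_⟩
    rw [(hρ c).2.1] at hjk
    rw [(hρ c).2.2]
    obtain ⟨h1, h2⟩ := hp (j, k) hjk
    refine ⟨p (j, k), h1, fun i hi => h2 ⟨hi.1, hi.2.1, fun y hy _ => hi.2.2 y hy ?_⟩⟩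
    refine WithTop.coe_lt_coe.2 ?_
    exact Prod.Lex.lt_iff.2 (Or.inl (hc (j, k) _ (Finset.mem_image.2 ⟨y, hy, rfl⟩)))
  refine ⟨F.h x, fun j => ?_⟩
  have h1 := (legit_iff.1 hx).2 j j (by rw [(hρ c).2.1]; exact hle j)
  refine ((h1.step (WithTop.coe_lt_top x) hx subset_rfl).mono fun i hi => ?_)
  have := hi.2
  rwa [(hρ c).2.2] at this

end Scheme

/-- The filter `D` solves all problems of the following kind, where `J` is directed, of size at
most `#I`, and bounds maps from `Θ₁` or from `Θ₂`: given relations `E · ·` on `J` which depend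
on `i : I`, are transitive, and extend the order of `J` for almost all `i`, find a function
`h : I → J` which is almost everywhere above every element of `J`. -/
def SolvesProblems {I : Type u} (D : Filter I) (Θ₁ Θ₂ : Type u) : Prop :=
  ∀ (J : Type u) (le : J → J → Prop) (E : J → J → Set I), Nonempty J → #J ≤ #I →
    (∀ j, le j j) → (∀ j k, ∃ l, le j l ∧ le k l) →
    (∀ i j k l, i ∈ E j k → i ∈ E k l → i ∈ E j l) →
    (BoundsMaps Θ₁ le ∨ BoundsMaps Θ₂ le) → (∀ j k, le j k → E j k ∈ D) →
    ∃ h : I → J, ∀ j, {i | i ∈ E j (h i)} ∈ D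

/-- The generic chain, and with it the filter, exists for any two regular cardinals of size at most
`#I` which are not both countable. -/
theorem exists_filter (I : Type u) [Infinite I] (Θ₁ Θ₂ : Type u) [LinearOrder Θ₁] [LinearOrder Θ₂]
    (hΘ₁ : (#Θ₁).IsRegular) (hΘ₂ : (#Θ₂).IsRegular) (hω : ℵ₀ < #Θ₁ ∨ ℵ₀ < #Θ₂)
    (h₁ : ∀ ξ : Θ₁, #(Set.Iic ξ) < #Θ₁) (h₂ : ∀ ζ : Θ₂, #(Set.Iic ζ) < #Θ₂)
    (hI₁ : #Θ₁ ≤ #I) (hI₂ : #Θ₂ ≤ #I) :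
    ∃ D : Filter I, IsRegularFilter D ∧
      (∃ q : I → (Θ₁ ⊕ₗ Θ₂ᵒᵈ) → ℚ, (∀ v w, v < w → ∀ᶠ i in D, q i v < q i w) ∧
        ∀ (U : Θ₁ → Set I) (V : Θ₂ → Set I), (∀ ξ, U ξ ∈ D) → (∀ ζ, V ζ ∈ D) →
          ∃ ξ ζ, ∃ i ∈ U ξ ∩ V ζ, q i (Sum.inrₗ (OrderDual.toDual ζ)) < q i (Sum.inlₗ ξ)) ∧
      SolvesProblems D Θ₁ Θ₂ := by
  classical
  let W := Θ₁ ⊕ₗ Θ₂ᵒᵈ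
  -- `R` lists all candidate problems on `I`, and the first coordinate in `K`, of type `(#I)⁺`,
  -- makes each of them recur cofinally.
  let R := (#((I → I → Prop) × (I → I → Set I))).ord.ToType
  let K := (Order.succ #I).ord.ToType
  have hKreg : (Order.succ #I).IsRegular := isRegular_succ (aleph0_le_mk I)
  have hcof : Order.cof K = Order.succ #I := by
    rw [Ordinal.cof_toType, hKreg.cof_ord]
  obtain ⟨e⟩ : Nonempty (R ≃ (I → I → Prop) × (I → I → Set I)) :=
    Cardinal.eq.1 (mk_ord_toType _)
  let X := K ×ₗ R
  let V := I × Finset I × (W →₀ ℚ)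
  have hω' : ℵ₀ ≤ #I := aleph0_le_mk I
  have hWI : #W ≤ #I := by
    have : #W = #Θ₁ + #Θ₂ := by
      rw [mk_congr (ofLex : W ≃ Θ₁ ⊕ Θ₂ᵒᵈ)]
      simp [mk_congr (OrderDual.ofDual : Θ₂ᵒᵈ ≃ Θ₂)]
    rw [this]
    exact add_le_of_le hω' hI₁ hI₂
  have hW' : #(W →₀ ℚ) ≤ #I := by
    have : Nonempty Θ₁ := mk_ne_zero_iff.1 hΘ₁.pos.ne'
    have : Nonempty W := ⟨Sum.inlₗ (Classical.arbitrary Θ₁)⟩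
    simpa [hω'] using hWI
  have hV : #V ≤ #I := by
    simp only [V, mk_prod, lift_id, mk_finset_of_infinite]
    exact mul_le_of_le hω' le_rfl (mul_le_of_le hω' le_rfl hW')
  -- Each stage gets its own independent function; the extra index `none` supplies `u` and `q`.
  have hX : #(Option X) ≤ #(Set I) := by
    have hK2 : #K ≤ 2 ^ #I := by
      rw [mk_ord_toType]
      exact Order.succ_le_of_lt (cantor _)
    have h2 : ℵ₀ ≤ (2 : Cardinal.{u}) ^ #I := hω'.trans (cantor _).le
    have hR2 : #R ≤ 2 ^ #I := by
      rw [mk_ord_toType, mk_prod]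
      simp only [lift_id, mk_pi, mk_set, prod_const, mk_Prop, lift_two, lift_uzero, ← power_mul, mul_eq_self hω']
      exact (mul_eq_self h2).le
    have hX2 : #X ≤ 2 ^ #I := by
      rw [mk_congr (ofLex : X ≃ K × R), mk_prod, lift_id, lift_id]
      exact mul_le_of_le h2 hK2 hR2
    rw [mk_option, mk_set]
    exact add_le_of_le h2 hX2 (one_le_aleph0.trans h2)
  have _ : Nonempty V := inferInstance
  obtain ⟨H, hH⟩ := exists_independent_functions I V hV
  obtain ⟨ι⟩ := hX
  let Good : (I → I → Prop) → (I → I → Set I) → Prop := fun le E =>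
    (∀ j, le j j) ∧ (∀ j k, ∃ l, le j l ∧ le k l) ∧
      (∀ i j k l, i ∈ E j k → i ∈ E k l → i ∈ E j l) ∧ (BoundsMaps Θ₁ le ∨ BoundsMaps Θ₂ le)
  let F : Scheme I W X :=
    { le := fun x => (e (ofLex x).2).1
      E := fun x => (e (ofLex x).2).2
      good := fun x => Good (e (ofLex x).2).1 (e (ofLex x).2).2
      h := fun x i => (H (ι (some x)) i).1
      u := fun i => (H (ι none) i).2.1
      q := fun i => (H (ι none) i).2.2
      le_refl := fun hg => hg.1
      directed := fun hg => hg.2.1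
      trans := fun {x} (hg : Good (e (ofLex x).2).1 (e (ofLex x).2).2) {i j k l} =>
        hg.2.2.1 i j k l }
  have hF : F.Independent := by
    intro D v c b r
    obtain ⟨i, hi⟩ := hH (insert (ι none) (D.image fun x => ι (some x)))
      (fun A => (if h : ∃ x ∈ D, ι (some x) = A then v h.choose else Classical.arbitrary I, c,
        Finsupp.onFinset b (fun w => if w ∈ b then r w else 0) (by
          intro w hw
          by_contra h
          exact hw (if_neg h))))
    refine ⟨i, fun x hx => ?_, ?_, fun w hw => ?_⟩
    · have h := hi (ι (some x)) (by simp [hx])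
      have hex : ∃ y ∈ D, ι (some y) = ι (some x) := ⟨x, hx, rfl⟩
      have h2 : hex.choose = x := by simpa using hex.choose_spec.2
      simp only [F, h, dif_pos hex, h2]
    · simp only [F, hi (ι none) (by simp)]
      exact subset_rfl
    · simp only [F, hi (ι none) (by simp), Finsupp.onFinset_apply, if_pos hw]
  refine ⟨F.filter, F.isRegularFilter_filter, ⟨F.q, fun v w h => F.eventually_lt h,
    fun U V hU hV => F.exists_mem_inter_lt hF hΘ₁ hΘ₂ hω h₁ h₂ (fun x hx => hx.2.2.2) hU hV⟩, ?_⟩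
  intro J le E hJ hJI hrefl hdir htrans hB hE
  obtain ⟨π, hπ⟩ : ∃ π : I → J, Function.Surjective π := by
    obtain ⟨f⟩ := hJI
    exact ⟨Function.invFun f, Function.invFun_surjective f.injective⟩
  have hgood : Good (fun j k => le (π j) (π k)) (fun j k => E (π j) (π k)) := by
    refine ⟨fun j => hrefl _, fun j k => ?_, fun i j k l => htrans i _ _ _,
      hB.imp (fun h => h.comap hπ) fun h => h.comap hπ⟩
    obtain ⟨l, hl⟩ := hdir (π j) (π k)
    obtain ⟨l', rfl⟩ := hπ l
    exact ⟨l', hl⟩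
  obtain ⟨h, hh⟩ := F.exists_solution (by rw [hcof]; exact Order.lt_succ _) (by rwa [hcof])
    (e.symm (fun j k => le (π j) (π k), fun j k => E (π j) (π k)))
    (fun j k => le (π j) (π k)) (fun j k => E (π j) (π k))
    (fun c => by simpa [F] using hgood) (fun j => hrefl _) (fun j k hjk => hE _ _ hjk)
  refine ⟨fun i => π (h i), fun j => ?_⟩
  obtain ⟨j', rfl⟩ := hπ j
  exact hh j'

/-! ### Filling pre-cuts, and the pre-cut given by the generic chain. -/

/-- A total preorder of regular cofinality `κ` has a cofinal family of size `κ` in which every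
smaller subfamily is bounded. -/
theorem exists_cofinal_family {C : Type w} [Preorder C] (htot : ∀ a b : C, a ≤ b ∨ b ≤ a)
    (κ : Cardinal.{u}) (h : Cardinal.lift.{u} (Order.cof C) = Cardinal.lift.{w} κ) :
    ∃ (A : Type u) (s : A → C), #A = κ ∧ (∀ c, ∃ a, c ≤ s a) ∧
      ∀ B : Set A, #B < #A → ∃ a, ∀ b ∈ B, s b ≤ s a := by
  obtain ⟨S, hS, hSc⟩ := Order.exists_cof_eq C
  obtain ⟨e⟩ : Nonempty (κ.out ≃ S) := by
    rw [← Cardinal.lift_mk_eq', hSc, mk_out, h]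
  refine ⟨κ.out, fun a => (e a : C), mk_out κ, fun c => ?_, fun B hB => ?_⟩
  · obtain ⟨y, hy, hcy⟩ := hS c
    exact ⟨e.symm ⟨y, hy⟩, by simpa using hcy⟩
  · have hnot : ¬ IsCofinal ((fun a => (e a : C)) '' B) := by
      intro hc
      have h1 : Cardinal.lift.{w} κ ≤ Cardinal.lift.{w} #B := by
        rw [← h]
        exact (Cardinal.lift_le.2 (Order.cof_le hc)).trans mk_image_le_lift
      rw [mk_out] at hB
      exact (Cardinal.lift_le.1 h1).not_gt hB
    unfold IsCofinal at hnot
    push Not at hnot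
    obtain ⟨x, hx⟩ := hnot
    obtain ⟨y, hy, hxy⟩ := hS x
    refine ⟨e.symm ⟨y, hy⟩, fun b hb => ?_⟩
    have := (htot x (e b)).resolve_left (hx _ ⟨b, hb, rfl⟩)
    simpa using this.trans hxy

/-- A directed family of nonempty internal sets has a common element in the reduced power. -/
theorem SolvesProblems.exists_forall_mem {I Θ₁ Θ₂ : Type u} {D : Filter I}
    (hD : SolvesProblems D Θ₁ Θ₂) {J : Type u} (le : J → J → Prop) [Nonempty J] (hJ : #J ≤ #I)
    (hrefl : ∀ j, le j j) (hdir : ∀ j k, ∃ l, le j l ∧ le k l)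
    (hB : BoundsMaps Θ₁ le ∨ BoundsMaps Θ₂ le) {N : Type w} [Nonempty N] (T : J → I → Set N)
    (hT : ∀ j k, le j k → ∀ᶠ i in D, (T k i).Nonempty ∧ T k i ⊆ T j i) :
    ∃ c : I → N, ∀ j, ∀ᶠ i in D, c i ∈ T j i := by
  classical
  -- Nonemptiness of `T k i` is part of the relation, so that at a solution `h` the set `T (h i) i`
  -- has an element to choose.
  obtain ⟨h, hh⟩ := hD J le (fun j k => {i | (T k i).Nonempty ∧ T k i ⊆ T j i}) inferInstance hJ
    hrefl hdir (fun i j k l h1 h2 => ⟨h2.1, h2.2.trans h1.2⟩) hB hT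
  refine ⟨fun i => if hi : (T (h i) i).Nonempty then hi.choose else Classical.arbitrary N,
    fun j => ?_⟩
  filter_upwards [hh j] with i hi
  have h1 : (T (h i) i).Nonempty := hi.1
  simp only [dif_pos h1]
  exact hi.2 h1.choose_spec

/-- Cofinal families of the two sides give the index set `A₁ × A₂`, which bounds maps from whichever
`Θ` has cardinality different from both `κ₁` and `κ₂`. The problem is to find a point in all the
intervals `Set.Icc (f j.1 i) (g j.2 i)`. -/
theorem SolvesProblems.not_hasPreCut {I Θ₁ Θ₂ : Type u} [Infinite I] {D : Filter I}
    (hD : SolvesProblems D Θ₁ Θ₂) (hΘ₁ : (#Θ₁).IsRegular) (hΘ₂ : (#Θ₂).IsRegular)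
    {κ₁ κ₂ : Cardinal.{u}} (hκ₁ : κ₁.IsRegular) (hκ₂ : κ₂.IsRegular) (hκ₁I : κ₁ ≤ #I)
    (hκ₂I : κ₂ ≤ #I) (hne : (#Θ₁ ≠ κ₁ ∧ #Θ₁ ≠ κ₂) ∨ (#Θ₂ ≠ κ₁ ∧ #Θ₂ ≠ κ₂))
    (M : Type v) [LinearOrder M] :
    ¬ HasPreCut (D.Germ M) (Cardinal.lift.{v} κ₁) (Cardinal.lift.{v} κ₂) := by
  rintro ⟨C₁, C₂, hC, h₁, h₂⟩
  obtain ⟨A₁, s₁, hA₁, hcof₁, hbdd₁⟩ := exists_cofinal_family (C := C₁)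
    (fun a b => (hC.chain.total (Or.inl a.2) (Or.inl b.2))) κ₁ (by
      rw [h₁, Cardinal.lift_lift, Cardinal.lift_umax.{u, v}])
  obtain ⟨A₂, s₂, hA₂, hcof₂, hbdd₂⟩ := exists_cofinal_family (C := (C₂)ᵒᵈ)
    (fun a b => (hC.chain.total (Or.inr (OrderDual.ofDual b).2) (Or.inr (OrderDual.ofDual a).2)))
    κ₂ (by
      rw [h₂, Cardinal.lift_lift, Cardinal.lift_umax.{u, v}])
  have hr₁ : ∀ a : A₁, ∃ f : I → M, (f : D.Germ M) = s₁ a := fun a =>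
    Quotient.exists_rep (s₁ a : D.Germ M)
  have hr₂ : ∀ a : A₂, ∃ f : I → M, (f : D.Germ M) = (OrderDual.ofDual (s₂ a) : C₂) := fun a =>
    Quotient.exists_rep ((OrderDual.ofDual (s₂ a) : C₂) : D.Germ M)
  choose f hf using hr₁
  choose g hg using hr₂
  have hne₁ : Nonempty A₁ := by rw [← mk_ne_zero_iff, hA₁]; exact hκ₁.pos.ne'
  have hne₂ : Nonempty A₂ := by rw [← mk_ne_zero_iff, hA₂]; exact hκ₂.pos.ne'
  have hdir₁ : ∀ a b : A₁, ∃ c, s₁ a ≤ s₁ c ∧ s₁ b ≤ s₁ c := by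
    intro a b
    rcases hC.chain.total (Or.inl (s₁ a).2) (Or.inl (s₁ b).2) with h | h
    · exact ⟨b, h, le_rfl⟩
    · exact ⟨a, le_rfl, h⟩
  have hdir₂ : ∀ a b : A₂, ∃ c, s₂ a ≤ s₂ c ∧ s₂ b ≤ s₂ c := by
    intro a b
    rcases hC.chain.total (Or.inr (OrderDual.ofDual (s₂ a)).2)
      (Or.inr (OrderDual.ofDual (s₂ b)).2) with h | h
    · exact ⟨a, le_rfl, h⟩
    · exact ⟨b, h, le_rfl⟩
  have hle₁ : ∀ a b, s₁ a ≤ s₁ b → f a ≤ᶠ[D] f b := fun a b h => by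
    have h' : (s₁ a : D.Germ M) ≤ s₁ b := h
    rw [← hf, ← hf] at h'
    exact Filter.Germ.coe_le.1 h'
  have hle₂ : ∀ a b, s₂ a ≤ s₂ b → g b ≤ᶠ[D] g a := fun a b h => by
    have h' : ((OrderDual.ofDual (s₂ b) : C₂) : D.Germ M) ≤ (OrderDual.ofDual (s₂ a) : C₂) := h
    rw [← hg, ← hg] at h'
    exact Filter.Germ.coe_le.1 h'
  have hle₁₂ : ∀ a b, f a ≤ᶠ[D] g b := fun a b => by
    have h' := hC.le _ (s₁ a).2 _ (OrderDual.ofDual (s₂ b)).2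
    rw [← hf, ← hg] at h'
    exact Filter.Germ.coe_le.1 h'
  have hb : ∀ Θ : Type u, (#Θ).IsRegular → #Θ ≠ κ₁ → #Θ ≠ κ₂ →
      BoundsMaps Θ fun j k : A₁ × A₂ => s₁ j.1 ≤ s₁ k.1 ∧ s₂ j.2 ≤ s₂ k.2 :=
    fun Θ hΘ h1 h2 => BoundsMaps.prod
      (boundsMaps_of_card_ne (r := fun a b => s₁ a ≤ s₁ b) hΘ (hA₁.symm ▸ h1) (fun _ => le_rfl) hbdd₁)
      (boundsMaps_of_card_ne (r := fun a b => s₂ a ≤ s₂ b) hΘ (hA₂.symm ▸ h2) (fun _ => le_rfl) hbdd₂)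
  have : Nonempty M := ⟨f (Classical.arbitrary A₁) (Classical.arbitrary I)⟩
  obtain ⟨c, hc⟩ := hD.exists_forall_mem (J := A₁ × A₂)
    (fun j k => s₁ j.1 ≤ s₁ k.1 ∧ s₂ j.2 ≤ s₂ k.2)
    (by
      rw [mk_prod, lift_id, lift_id, hA₁, hA₂]
      exact mul_le_of_le (aleph0_le_mk I) hκ₁I hκ₂I)
    (fun j => ⟨le_rfl, le_rfl⟩)
    (fun j k => by
      obtain ⟨a, ha⟩ := hdir₁ j.1 k.1
      obtain ⟨b, hb⟩ := hdir₂ j.2 k.2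
      exact ⟨(a, b), ⟨ha.1, hb.1⟩, ha.2, hb.2⟩)
    (hne.imp (fun h => hb Θ₁ hΘ₁ h.1 h.2) fun h => hb Θ₂ hΘ₂ h.1 h.2)
    (fun j i => Set.Icc (f j.1 i) (g j.2 i))
    (fun j k hjk => by
      filter_upwards [hle₁ _ _ hjk.1, hle₂ _ _ hjk.2, hle₁₂ k.1 k.2] with i h1 h2 h3
      exact ⟨Set.nonempty_Icc.2 h3, Set.Icc_subset_Icc h1 h2⟩)
  refine hC.unfilled ⟨(c : D.Germ M), fun a ha => ?_, fun b hb => ?_⟩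
  · obtain ⟨x, hx⟩ := hcof₁ ⟨a, ha⟩
    refine le_trans (b := (s₁ x : D.Germ M)) hx ?_
    rw [← hf]
    refine Filter.Germ.coe_le.2 ?_
    filter_upwards [hc (x, Classical.arbitrary A₂)] with i hi using hi.1
  · obtain ⟨x, hx⟩ := hcof₂ (OrderDual.toDual ⟨b, hb⟩)
    refine le_trans (b := ((OrderDual.ofDual (s₂ x) : C₂) : D.Germ M)) ?_ hx
    rw [← hg]
    refine Filter.Germ.coe_le.2 ?_
    filter_upwards [hc (Classical.arbitrary A₁, x)] with i hi using hi.2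

/-- If `c` filled the image of the chain, the sets where `c i` lies above the `ξ`-th, respectively
below the `ζ`-th, value would be in `D`. Then `hq` yields a point where these values are in the
wrong order. -/
theorem hasPreCut_of_generic_chain {I : Type u} {D : Filter I} [D.NeBot] {θ₁ θ₂ : Cardinal.{u}}
    (hθ₁ : θ₁.IsRegular) (hθ₂ : θ₂.IsRegular)
    (q : I → (θ₁.ord.ToType ⊕ₗ (θ₂.ord.ToType)ᵒᵈ) → ℚ)
    (hlt : ∀ v w, v < w → ∀ᶠ i in D, q i v < q i w)
    (hq : ∀ (U : θ₁.ord.ToType → Set I) (V : θ₂.ord.ToType → Set I), (∀ ξ, U ξ ∈ D) →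
      (∀ ζ, V ζ ∈ D) → ∃ ξ ζ, ∃ i ∈ U ξ ∩ V ζ,
        q i (Sum.inrₗ (OrderDual.toDual ζ)) < q i (Sum.inlₗ ξ))
    (M : Type v) [LinearOrder M] [DenselyOrdered M] [Nontrivial M] :
    HasPreCut (D.Germ M) (Cardinal.lift.{v} θ₁) (Cardinal.lift.{v} θ₂) := by
  obtain ⟨e⟩ := Order.embedding_from_countable_to_dense ℚ M
  let F : (θ₁.ord.ToType ⊕ₗ (θ₂.ord.ToType)ᵒᵈ) → D.Germ M := fun w => ((fun i => e (q i w) : I → M))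
  have hF : StrictMono F := by
    intro v w h
    refine lt_iff_le_not_ge.2 ⟨Filter.Germ.coe_le.2 ?_, fun hle => ?_⟩
    · filter_upwards [hlt v w h] with i hi using e.monotone hi.le
    · obtain ⟨i, h1, h2⟩ := ((Filter.Germ.coe_le.1 hle).and (hlt v w h)).exists
      exact (e.lt_iff_lt.2 h2).not_ge h1
  have hF₁ : StrictMono fun ξ : θ₁.ord.ToType => F (Sum.inlₗ ξ) :=
    fun a b h => hF (Sum.Lex.inl_lt_inl_iff.2 h)
  have hF₂ : StrictMono fun ζ : (θ₂.ord.ToType)ᵒᵈ => F (Sum.inrₗ ζ) :=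
    fun a b h => hF (Sum.Lex.inr_lt_inr_iff.2 h)
  refine ⟨Set.range fun ξ : θ₁.ord.ToType => F (Sum.inlₗ ξ),
    Set.range fun ζ : (θ₂.ord.ToType)ᵒᵈ => F (Sum.inrₗ ζ), ⟨?_, ?_, ?_⟩, ?_, ?_⟩
  · have : IsChain (· ≤ ·) (Set.range F) := by
      rintro _ ⟨v, rfl⟩ _ ⟨w, rfl⟩ -
      exact (le_total v w).imp (fun h => hF.monotone h) fun h => hF.monotone h
    refine this.mono ?_
    rintro _ (⟨ξ, rfl⟩ | ⟨ζ, rfl⟩) <;> exact ⟨_, rfl⟩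
  · rintro _ ⟨ξ, rfl⟩ _ ⟨ζ, rfl⟩
    exact (hF (Sum.Lex.inl_lt_inr _ _)).le
  · rintro ⟨c, hc₁, hc₂⟩
    obtain ⟨c, rfl⟩ := Quotient.exists_rep c
    obtain ⟨ξ, ζ, i, ⟨h1, h2⟩, hi⟩ := hq (fun ξ => {i | e (q i (Sum.inlₗ ξ)) ≤ c i})
      (fun ζ => {i | c i ≤ e (q i (Sum.inrₗ (OrderDual.toDual ζ)))})
      (fun ξ => Filter.Germ.coe_le.1 (hc₁ _ ⟨ξ, rfl⟩))
      (fun ζ => Filter.Germ.coe_le.1 (hc₂ _ ⟨OrderDual.toDual ζ, rfl⟩))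
    exact (e.lt_iff_lt.2 hi).not_ge (le_trans h1 h2)
  · have := (StrictMono.orderIso _ hF₁).lift_cof_congr
    rw [Ordinal.cof_toType, hθ₁.cof_ord] at this
    rw [Cardinal.lift_umax.{u, v}, Cardinal.lift_id'.{u, v}] at this
    exact this.symm
  · have := ((OrderIso.dualDual _).trans (StrictMono.orderIso _ hF₂).dual).lift_cof_congr
    rw [Ordinal.cof_toType, hθ₂.cof_ord] at this
    rw [Cardinal.lift_umax.{u, v}, Cardinal.lift_id'.{u, v}] at this
    exact this.symm

/-! ### Towers and the binary tree. -/

/-- If the relation `r` is a strict order without maximal elements, then some increasing sequence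
whose length is an infinite cardinal has no upper bound. -/
theorem exists_unbounded_tower {X : Type u} [Nonempty X] (r : X → X → Prop)
    (hirr : ∀ x, ¬ r x x) (htrans : ∀ x y z, r x y → r y z → r x z) (hmax : ∀ x, ∃ y, r x y) :
    ∃ κ : Cardinal.{u}, ℵ₀ ≤ κ ∧ ∃ f : κ.ord.ToType → X,
      (∀ α β, α < β → r (f α) (f β)) ∧ ¬ ∃ x, ∀ α, r (f α) x := by
  classical
  by_contra! hcon
  -- If every tower had a bound, recursion would give an increasing, hence injective, sequence of
  -- length `(#X)⁺` in `X`.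
  let K := (Order.succ #X).ord.ToType
  let step : (α : K) → ((β : K) → β < α → X) → X := fun α ih =>
    if h : ∃ x, ∀ β hβ, r (ih β hβ) x then h.choose else Classical.arbitrary X
  let f : K → X := wellFounded_lt.fix step
  have hf : ∀ α, (∃ x, ∀ β < α, r (f β) x) → ∀ β < α, r (f β) (f α) := by
    intro α h
    have h1 : f α = h.choose := by
      change wellFounded_lt.fix step α = _
      rw [WellFounded.fix_eq]
      exact dif_pos h
    rw [h1]
    exact h.choose_spec
  have hinc : ∀ α, ∀ β < α, r (f β) (f α) := by
    intro α
    induction α using WellFoundedLT.induction with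
    | ind α ih =>
    apply hf
    by_cases hne : (Set.Iio α).Nonempty
    swap
    · exact ⟨Classical.arbitrary X, fun β hβ => absurd ⟨β, hβ⟩ hne⟩
    by_cases hmx : ∃ β < α, ∀ γ < α, γ ≤ β
    · obtain ⟨β, hβ, hle⟩ := hmx
      obtain ⟨y, hy⟩ := hmax (f β)
      refine ⟨y, fun γ hγ => ?_⟩
      rcases (hle γ hγ).lt_or_eq with h | rfl
      · exact htrans _ _ _ (ih β hβ γ h) hy
      · exact hy
    push Not at hmx
    have : Nonempty (Set.Iio α) := hne.to_subtype
    have : NoMaxOrder (Set.Iio α) := ⟨fun β => by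
      obtain ⟨γ, h1, h2⟩ := hmx β β.2
      exact ⟨⟨γ, h1⟩, h2⟩⟩
    -- Bounds are available only for sequences of cardinal length, so at a limit `α` a cofinal
    -- subset whose order type is the cofinality is used.
    obtain ⟨s, hs, hst⟩ := Ordinal.exists_ord_cof_eq (Set.Iio α)
    let κ := Order.cof (Set.Iio α)
    obtain ⟨e⟩ : Nonempty (κ.ord.ToType ≃o s) := by
      obtain ⟨e⟩ := Ordinal.type_eq.1 ((Ordinal.type_toType κ.ord).trans hst.symm)
      exact ⟨OrderIso.ofRelIsoLT e⟩
    obtain ⟨x, hx⟩ := hcon κ Order.aleph0_le_cof (fun a => f (e a).1.1) fun a b hab =>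
      ih _ (e b).1.2 _ (e.lt_iff_lt.2 hab)
    refine ⟨x, fun β hβ => ?_⟩
    obtain ⟨γ, hγ, hle⟩ := hs ⟨β, hβ⟩
    have h1 : r (f γ.1) x := by simpa using hx (e.symm ⟨γ, hγ⟩)
    rcases (show β ≤ γ.1 from hle).lt_or_eq with h | h
    · exact htrans _ _ _ (ih _ γ.2 _ h) h1
    · rwa [h]
  have hinj : Function.Injective f := by
    intro α β hαβ
    by_contra hne
    rcases lt_or_gt_of_ne hne with h | h
    · exact hirr _ (hαβ ▸ hinc β α h)
    · exact hirr _ (hαβ ▸ hinc α β h)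
  have := mk_le_of_injective hinj
  rw [mk_ord_toType] at this
  exact (Order.lt_succ #X).not_ge this

/-- Since `sInf ∅ = 0`, the lower bound also needs an unbounded tower of some length to exist. -/
theorem succ_le_towerNumber {X : Type u} [Nonempty X] (r : X → X → Prop) (lam : Cardinal.{u})
    (hirr : ∀ x, ¬ r x x) (htrans : ∀ x y z, r x y → r y z → r x z) (hmax : ∀ x, ∃ y, r x y)
    (h : ∀ κ : Cardinal.{u}, ℵ₀ ≤ κ → κ ≤ lam → ∀ f : κ.ord.ToType → X,
      (∀ α β, α < β → r (f α) (f β)) → ∃ x, ∀ α, r (f α) x) :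
    Order.succ lam ≤ towerNumber r := by
  refine le_csInf (exists_unbounded_tower r hirr htrans hmax) ?_
  rintro κ ⟨hκ, f, hf, hno⟩
  refine Order.succ_le_of_lt (not_le.1 fun hle => hno (h κ hκ hle f hf))

theorem BinPrefix.trans {s t v : List Bool} (h₁ : BinPrefix s t) (h₂ : BinPrefix t v) :
    BinPrefix s v :=
  List.IsPrefix.trans h₁ h₂

theorem BinPrefix.antisymm {s t : List Bool} (h₁ : BinPrefix s t) (h₂ : BinPrefix t s) : s = t :=
  h₁.eq_of_length (le_antisymm h₁.length_le h₂.length_le)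

theorem BinPrefix.trans_strict {s t v : List Bool} (h₁ : BinPrefix s t)
    (h₂ : BinStrictPrefix t v) : BinStrictPrefix s v :=
  ⟨h₁.trans h₂.1, fun h => h₂.2 (BinPrefix.antisymm h₂.1 (h ▸ h₁))⟩

theorem binStrictPrefix_append (s : List Bool) : BinStrictPrefix s (s ++ [true]) :=
  ⟨List.prefix_append _ _, by simp⟩

/-- Increasing sequences in the reduced power of the binary tree have strict upper bounds. -/
theorem SolvesProblems.exists_tree_bound {I Θ₁ Θ₂ : Type u} [Infinite I] {D : Filter I}
    (hD : SolvesProblems D Θ₁ Θ₂) (hΘ₁ : (#Θ₁).IsRegular) (hΘ₂ : (#Θ₂).IsRegular)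
    (hne : #Θ₁ ≠ #Θ₂) {κ : Cardinal.{u}} (hκ : ℵ₀ ≤ κ) (hκI : κ ≤ #I)
    (f : κ.ord.ToType → D.Germ (List Bool))
    (hf : ∀ α β, α < β → Filter.Germ.LiftRel BinPrefix (f α) (f β)) :
    ∃ x, ∀ α, treeLT D (f α) x := by
  have hreg : κ.ord.cof.IsRegular := isRegular_cof (isSuccLimit_ord hκ)
  obtain ⟨A, s, hA, hcof, hbdd⟩ := exists_cofinal_family (C := κ.ord.ToType) le_total κ.ord.cof
    (by rw [Ordinal.cof_toType])
  have hr : ∀ α, ∃ g : I → List Bool, (g : D.Germ (List Bool)) = f α := fun α =>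
    Quotient.exists_rep (f α)
  choose g hg using hr
  have hle : ∀ α β, α ≤ β → ∀ᶠ i in D, BinPrefix (g α i) (g β i) := by
    intro α β h
    rcases h.lt_or_eq with h | rfl
    · have := hf α β h
      rw [← hg, ← hg] at this
      exact this
    · exact Filter.Eventually.of_forall fun i => List.prefix_refl _
  have : Nonempty A := by rw [← mk_ne_zero_iff, hA]; exact hreg.pos.ne'
  have hb : ∀ Θ : Type u, (#Θ).IsRegular → #Θ ≠ #A → BoundsMaps Θ fun a b : A => s a ≤ s b :=
    fun Θ hΘ h => boundsMaps_of_card_ne hΘ h (fun _ => le_rfl) hbdd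
  obtain ⟨c, hc⟩ := hD.exists_forall_mem (J := A) (fun a b => s a ≤ s b)
    (by rw [hA]; exact (Ordinal.cof_ord_le κ).trans hκI) (fun _ => le_rfl)
    (fun a b => (le_total (s a) (s b)).elim (fun h => ⟨b, h, le_rfl⟩) fun h => ⟨a, le_rfl, h⟩)
    -- The cofinality of the sequence equals at most one of `#Θ₁` and `#Θ₂`, and the other one makes
    -- the problem admissible.
    (by
      by_cases h : #Θ₁ = #A
      · exact Or.inr (hb Θ₂ hΘ₂ fun h' => hne (h.trans h'.symm))
      · exact Or.inl (hb Θ₁ hΘ₁ h))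
    (fun a i => {t | BinStrictPrefix (g (s a) i) t})
    (fun a b hab => by
      filter_upwards [hle _ _ hab] with i hi
      exact ⟨⟨_, binStrictPrefix_append _⟩, fun t ht => hi.trans_strict ht⟩)
  refine ⟨(c : D.Germ (List Bool)), fun α => ?_⟩
  obtain ⟨a, ha⟩ := hcof α
  rw [← hg]
  refine Filter.Germ.liftRel_coe.2 ?_
  filter_upwards [hle _ _ ha, hc a] with i h1 h2 using h1.trans_strict h2

section Tree

variable {I : Type u} {D : Filter I}

theorem treeLT.treePosetLT [D.NeBot] {x y : D.Germ (List Bool)} (h : treeLT D x y) :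
    treePosetLT D x y := by
  induction x using Filter.Germ.inductionOn with | _ x
  induction y using Filter.Germ.inductionOn with | _ y
  have h' : ∀ᶠ i in D, BinStrictPrefix (x i) (y i) := h
  refine ⟨h'.mono fun i hi => hi.1, fun he => ?_⟩
  obtain ⟨i, h1, h2⟩ := (h'.and (Filter.Germ.coe_eq.1 he)).exists
  exact h1.2 h2

theorem treeLT_irrefl [D.NeBot] (x : D.Germ (List Bool)) : ¬ treeLT D x x :=
  fun h => h.treePosetLT.2 rfl

theorem treeLT_trans (x y z : D.Germ (List Bool)) (h₁ : treeLT D x y) (h₂ : treeLT D y z) :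
    treeLT D x z := by
  induction x using Filter.Germ.inductionOn with | _ x
  induction y using Filter.Germ.inductionOn with | _ y
  induction z using Filter.Germ.inductionOn with | _ z
  have h₁' : ∀ᶠ i in D, BinStrictPrefix (x i) (y i) := h₁
  have h₂' : ∀ᶠ i in D, BinStrictPrefix (y i) (z i) := h₂
  refine Filter.Germ.liftRel_coe.2 ?_
  filter_upwards [h₁', h₂'] with i h1 h2 using BinPrefix.trans_strict h1.1 h2

theorem exists_treeLT (x : D.Germ (List Bool)) : ∃ y, treeLT D x y := by
  induction x using Filter.Germ.inductionOn with | _ x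
  exact ⟨((fun i => x i ++ [true] : I → List Bool) : D.Germ (List Bool)),
    Filter.Germ.liftRel_coe.2 (Filter.Eventually.of_forall fun i => binStrictPrefix_append _)⟩

theorem treePosetLT_trans (x y z : D.Germ (List Bool)) (h₁ : treePosetLT D x y)
    (h₂ : treePosetLT D y z) : treePosetLT D x z := by
  induction x using Filter.Germ.inductionOn with | _ x
  induction y using Filter.Germ.inductionOn with | _ y
  induction z using Filter.Germ.inductionOn with | _ z
  have h₁' : ∀ᶠ i in D, BinPrefix (x i) (y i) := h₁.1
  have h₂' : ∀ᶠ i in D, BinPrefix (y i) (z i) := h₂.1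
  refine ⟨Filter.Germ.liftRel_coe.2 ?_, fun he => h₁.2 (Filter.Germ.coe_eq.2 ?_)⟩
  · filter_upwards [h₁', h₂'] with i h1 h2 using h1.trans h2
  · filter_upwards [h₁', h₂', Filter.Germ.coe_eq.1 he] with i h1 h2 h3
    exact h1.antisymm (h3 ▸ h2)

end Tree

theorem mk_Iic_toType_ord_lt {κ : Cardinal.{u}} (hκ : ℵ₀ ≤ κ) (α : κ.ord.ToType) :
    #(Set.Iic α) < #κ.ord.ToType := by
  have h1 : #(Set.Iio α) < #κ.ord.ToType := mk_Iio_lt α (by simp)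
  rw [← Set.Iio_insert]
  refine lt_of_le_of_lt mk_insert_le (add_lt_of_lt (by simpa using hκ) h1 ?_)
  exact one_lt_aleph0.trans_le (by simpa using hκ)

/-! ### The main theorem. -/

theorem theorem4 (I : Type u) (lam θ₁ θ₂ : Cardinal.{u}) (hI : #I = lam)
    (hθ₁ : θ₁.IsRegular) (hθ₂ : θ₂.IsRegular) (hθ₁lam : θ₁ ≤ lam) (hθ₂lam : θ₂ ≤ lam)
    (hθ : ℵ₀ < θ₁ + θ₂) :
    ∃ D : Filter I, D.NeBot ∧ IsRegularFilter D ∧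
      (∀ (M : Type v) [LinearOrder M] [DenselyOrdered M] [Nontrivial M],
        HasPreCut (D.Germ M) (Cardinal.lift.{v} θ₁) (Cardinal.lift.{v} θ₂) ∧
        ∀ κ₁ κ₂ : Cardinal.{u}, κ₁.IsRegular → κ₂.IsRegular → κ₁ ≤ lam → κ₂ ≤ lam →
          ¬ ({θ₁, θ₂} : Set Cardinal.{u}) ⊆ {κ₁, κ₂} →
          ¬ HasPreCut (D.Germ M) (Cardinal.lift.{v} κ₁) (Cardinal.lift.{v} κ₂)) ∧
      (θ₁ ≠ θ₂ →
        Order.succ lam ≤ towerNumber (treeLT D) ∧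
        Order.succ lam ≤ towerNumber (treePosetLT D)) := by
  subst hI
  have : Infinite I := infinite_iff.2 (hθ₁.aleph0_le.trans hθ₁lam)
  have e₁ : #θ₁.ord.ToType = θ₁ := mk_ord_toType θ₁
  have e₂ : #θ₂.ord.ToType = θ₂ := mk_ord_toType θ₂
  have r₁ : (#θ₁.ord.ToType).IsRegular := e₁.symm ▸ hθ₁
  have r₂ : (#θ₂.ord.ToType).IsRegular := e₂.symm ▸ hθ₂
  have hω : ℵ₀ < #θ₁.ord.ToType ∨ ℵ₀ < #θ₂.ord.ToType := by
    rw [e₁, e₂, ← lt_max_iff, ← add_eq_max hθ₁.aleph0_le]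
    exact hθ
  obtain ⟨D, hreg, ⟨q, hlt, hq⟩, hD⟩ := exists_filter I θ₁.ord.ToType θ₂.ord.ToType r₁ r₂ hω
    (mk_Iic_toType_ord_lt hθ₁.aleph0_le) (mk_Iic_toType_ord_lt hθ₂.aleph0_le)
    (e₁.symm ▸ hθ₁lam) (e₂.symm ▸ hθ₂lam)
  -- In an improper filter the empty sets would be admissible as `U ξ` and `V ζ`, but `hq` puts a
  -- point in their intersection.
  have hne : D.NeBot := by
    refine ⟨fun h => ?_⟩
    obtain ⟨_, _, i, hi, -⟩ := hq (fun _ => ∅) (fun _ => ∅) (by simp [h]) (by simp [h])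
    exact hi.1
  refine ⟨D, hne, hreg, fun M _ _ _ => ⟨hasPreCut_of_generic_chain hθ₁ hθ₂ q hlt hq M, ?_⟩, ?_⟩
  · intro κ₁ κ₂ hκ₁ hκ₂ hκ₁I hκ₂I hsub
    refine hD.not_hasPreCut r₁ r₂ hκ₁ hκ₂ hκ₁I hκ₂I ?_ M
    rw [e₁, e₂]
    by_contra hcon
    refine hsub ?_
    rw [Set.insert_subset_iff, Set.singleton_subset_iff]
    simp only [Set.mem_insert_iff, Set.mem_singleton_iff]
    tauto
  · intro hθne
    have hb := fun (κ : Cardinal.{u}) (hκ : ℵ₀ ≤ κ) (hκI : κ ≤ #I) =>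
      hD.exists_tree_bound r₁ r₂ (by rwa [e₁, e₂]) hκ hκI
    have hnonempty : Nonempty (D.Germ (List Bool)) := ⟨((fun _ => [] : I → List Bool))⟩
    constructor
    · refine succ_le_towerNumber _ _ treeLT_irrefl treeLT_trans exists_treeLT
        fun κ hκ hκI f hf => hb κ hκ hκI f fun α β h => (hf α β h).treePosetLT.1
    · refine succ_le_towerNumber _ _ (fun x h => h.2 rfl) treePosetLT_trans
        (fun x => (exists_treeLT x).imp fun y h => h.treePosetLT) fun κ hκ hκI f hf => ?_
      obtain ⟨x, hx⟩ := hb κ hκ hκI f fun α β h => (hf α β h).1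
      exact ⟨x, fun α => (hx α).treePosetLT⟩
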